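/- Let $k$ be a perfect field of characteristic $p>0$, $\mathcal O=W(k)$, $K=\mathcal O[1/p]$, $\Gamma_+=\mathcal O[[u]]$, $\mathcal E_+=\Gamma_+[1/p]\subset K[[u]]$, and let $\mathcal R_+\supset\mathcal E_+$ be the ring of all $\sum_{i\ge 0}x_iu^i\in K[[u]]$ with $\liminf_{i\to\infty}v_p(x_i)/i\ge 0$. Each of $\Gamma_+,\mathcal E_+,\mathcal R_+$ carries the differential $d(\sum x_iu^i)=(\sum ix_iu^{i-1})\,du$, and on $\mathcal O[[u,x]]$ put $df=\frac{\partial f}{\partial u}du+\frac{\partial f}{\partial x}dx$. Write $U(R)$ for the group of upper triangular unipotent $2\times2$ matrices over $R$. For $\bar v\in k[[t]]^*$ let $\log^\dagger(\bar v)\in\mathcal E_+\backslash\mathcal R_+$ be the class of any $w\in\mathcal R_+$ with $dw=dy/y$, where $y\in\Gamma_+^*$ is any lift of $\bar v$ (the lift being along $u\mapsto t$ and $\mathcal O\to k$); for $v\in\Gamma_+^*$ write $\log^\dagger(v)$ for $\log^\dagger$ of its reduction in $k[[t]]^*$. A framed $\nabla$-module of signature $(1,1)$ is a free module $M$ of rank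 $2$ with a connection $\nabla$ and a basis $e_1,e_2$ with $\nabla e_1=0$ and $\nabla e_2\in e_1\otimes\Omega^1$. Its invariant, if $M$ is over $\mathcal E_+$, is the double coset in $U(\mathcal E_+)\backslash U(\mathcal R_+)/U(K)$ of the matrix, with respect to $e_1,e_2$ (or any basis $e_1,\ e_2+se_1$ with $s\in\mathcal E_+$), of a horizontal isomorphism $\phi$ from $M\otimes\mathcal R_+$ to the trivial $\nabla$-module $\mathcal R_+^2$ with $\phi(e_1)=(1,0)$ and $\phi(e_2)\in(0,1)+\mathcal R_+\cdot(1,0)$. The invariant of such a module over $\Gamma_+$ is that of its base change to $\mathcal E_+$. Let $X=\mathrm{Spf}(\mathcal O[[u,x]])$ and let $X(\Gamma_+)$ be the set of sections of $X\to\mathrm{Spf}(\Gamma_+)$, i.e. of $\Gamma_+$-algebra homomorphisms $\psi:\mathcal O[[u,x]]\to\Gamma_+$ continuous for the $(p,u,x)$-adic and $(p,u)$-adic topologies. Let $\mathbf M$ be the framed $\nabla$-module $\mathcal O[[u,x]]^{2}$ on $X$ with $\nabla e_1=0$ and $\nabla e_2=e_1\otimes\frac{dx}{1+x}$, and let $\int_{\mathbf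 M}(\psi)$ be the invariant of $\psi^*\mathbf M$. Then: (1) $\psi\mapsto\psi(1+x)$ is a bijection from $X(\Gamma_+)$ onto the set of those $v\in\Gamma_+^*$ with $v\equiv1\bmod (p,u)$. (2) The map $\begin{pmatrix}1&w\\0&1\end{pmatrix}\mapsto w$ induces a bijection $U(\mathcal E_+)\backslash U(\mathcal R_+)/U(K)\cong\mathcal E_+\backslash\mathcal R_+$. (3) For $\psi\in X(\Gamma_+)$ and $v=\psi(1+x)$, the framed $\nabla$-module $\psi^*\mathbf M$ is isomorphic to $\mathbf N_v=(\Gamma_+^2,\ \nabla e_1=0,\ \nabla e_2=e_1\otimes\frac{dv}{v})$; the invariant $\int_{\mathbf M}(\psi)$ exists, is unique, and under (2) equals $\log^\dagger(v)$. (4) More generally, for every $v\in\Gamma_+^*$ the invariant of $\mathbf N_v$ exists, is unique, and under (2) equals $\log^\dagger(v)$. -/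

import Mathlib

set_option linter.unusedSectionVars false
open scoped TensorProduct PowerSeries

universe u

namespace PadicLineIntegral

noncomputable section

section Connections

variable {B R Ω : Type u} [CommRing B] [CommRing R] [Algebra B R] [AddCommGroup Ω] [Module B Ω]
  [Module R Ω]

/-- A connection on the `R`-module `M`, where `R` carries the `B`-linear derivation
`d : R → Ω` (`Ω` playing the role of the module of differentials): an additive map
`∇ : M → M ⊗ Ω` with the Leibniz rule. Its `B`-linearity follows, see `Connection.map_smul_base`. -/
structure Connection (d : Derivation B R Ω) (M : Type u) [AddCommGroup M] [Module R M] where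
  toFun : M →+ M ⊗[R] Ω
  leibniz : ∀ (c : R) (m : M), toFun (c • m) = c • toFun m + m ⊗ₜ[R] d c

instance (d : Derivation B R Ω) (M : Type u) [AddCommGroup M] [Module R M] :
    CoeFun (Connection d M) (fun _ => M → M ⊗[R] Ω) := ⟨fun nabla => nabla.toFun⟩

theorem Connection.map_smul_base {d : Derivation B R Ω} {M : Type u} [AddCommGroup M] [Module R M]
    (nabla : Connection d M) (b : B) (m : M) :
    nabla (algebraMap B R b • m) = algebraMap B R b • nabla m := by
  rw [nabla.leibniz, Derivation.map_algebraMap, TensorProduct.tmul_zero, add_zero]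

/-- A framed `∇`-module of signature `(1,1)` over `(R, d : R → Ω)`: a free module `M` of rank two
with a connection and a basis `e 0, e 1` such that the span `M₁` of `e 0` is a sub-`∇`-module,
`e 0` is a horizontal basis of `M₁`, and the image of `e 1` is a horizontal basis of `M / M₁`. -/
structure FramedModule (d : Derivation B R Ω) where
  M : Type u
  [addCommGroup : AddCommGroup M]
  [module : Module R M]
  nabla : Connection d M
  e : Module.Basis (Fin 2) R M
  nabla_e_zero : nabla (e 0) = 0
  nabla_e_one : ∃ ω : Ω, nabla (e 1) = e 0 ⊗ₜ[R] ω

attribute [instance] FramedModule.addCommGroup FramedModule.module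

/-- Isomorphism of framed `∇`-modules: a horizontal linear isomorphism that maps the frame of `N`
to the frame of `N'`. -/
def FramedModule.Iso {d : Derivation B R Ω} (N N' : FramedModule d) : Prop :=
  ∃ f : N.M ≃ₗ[R] N'.M,
    (∀ m : N.M, N'.nabla (f m) = f.toLinearMap.rTensor Ω (N.nabla m)) ∧ ∀ i, f (N.e i) = N'.e i

/-- The connection on `R²` with `∇ e₁ = 0` and `∇ e₂ = e₁ ⊗ ω`. -/
def dlogConnection (d : Derivation B R Ω) (ω : Ω) : Connection d (Fin 2 → R) where
  toFun := AddMonoidHom.mk' (fun m => Pi.single 0 1 ⊗ₜ[R] (d (m 0) + m 1 • ω)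
      + Pi.single 1 1 ⊗ₜ[R] d (m 1)) (by
    intro a b
    simp only [Pi.add_apply, map_add, add_smul, TensorProduct.tmul_add]
    abel)
  leibniz := by
    intro c m
    have hm : m = m 0 • Pi.single 0 1 + m 1 • Pi.single 1 1 := by
      ext i; fin_cases i <;> simp
    have hm' : m ⊗ₜ[R] d c = Pi.single 0 1 ⊗ₜ[R] (m 0 • d c)
        + (Pi.single 1 1 : Fin 2 → R) ⊗ₜ[R] (m 1 • d c) := by
      conv_lhs => rw [hm]
      rw [TensorProduct.add_tmul, TensorProduct.smul_tmul, TensorProduct.smul_tmul]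
    simp only [AddMonoidHom.mk'_apply]
    rw [hm']
    simp only [Pi.smul_apply, smul_eq_mul, Derivation.leibniz, TensorProduct.tmul_add,
      TensorProduct.tmul_smul, smul_add, mul_smul]
    abel

/-- The framed `∇`-module `R²` with its standard basis `e₁, e₂`, where `∇ e₁ = 0` and
`∇ e₂ = e₁ ⊗ ω`. -/
def dlogModule (d : Derivation B R Ω) (ω : Ω) : FramedModule d where
  M := Fin 2 → R
  nabla := dlogConnection d ω
  e := Pi.basisFun R (Fin 2)
  nabla_e_zero := by
    simp [dlogConnection]
  nabla_e_one := ⟨ω, by simp [dlogConnection]⟩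

/-- The trivial connection of `R²`, that is `d` in each coordinate. -/
def trivialConnection (d : Derivation B R Ω) : Connection d (Fin 2 → R) :=
  dlogConnection d 0

/-- The connection is given by `d` in each coordinate. -/
theorem trivialConnection_apply (d : Derivation B R Ω) (m : Fin 2 → R) :
    trivialConnection d m = ∑ i, Pi.single i 1 ⊗ₜ[R] d (m i) := by
  simp [trivialConnection, dlogConnection]

/-- A trivialization of the framed `∇`-module `N`: a horizontal isomorphism `φ` of `M` with the
trivial `∇`-module `T = R²` that respects the filtrations and induces on the graded pieces
`M₁` and `M / M₁` the isomorphisms with `R` given by the frame. -/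
structure FramedModule.Trivialization {d : Derivation B R Ω} (N : FramedModule d) where
  φ : N.M ≃ₗ[R] (Fin 2 → R)
  horizontal : ∀ m : N.M, trivialConnection d (φ m) = φ.toLinearMap.rTensor Ω (N.nabla m)
  map_e_zero : φ (N.e 0) = Pi.single 0 1
  map_e_one : φ (N.e 1) - Pi.single 1 1 ∈ Submodule.span R {(Pi.single 0 1 : Fin 2 → R)}

/-- Two frames of the same `∇`-module define the same filtered `∇`-module: they span the same `M₁`
and have the same images in `M₁` and in `M / M₁`. -/
def FramedModule.Compatible {d : Derivation B R Ω} (N : FramedModule d)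
    (e' : Module.Basis (Fin 2) R N.M) : Prop :=
  e' 0 = N.e 0 ∧ e' 1 - N.e 1 ∈ Submodule.span R {N.e 0}

/-- The same `∇`-module with another compatible frame. -/
def FramedModule.reframe {d : Derivation B R Ω} (N : FramedModule d)
    (e' : Module.Basis (Fin 2) R N.M) (h : N.Compatible e') : FramedModule d where
  M := N.M
  nabla := N.nabla
  e := e'
  nabla_e_zero := by rw [h.1, N.nabla_e_zero]
  nabla_e_one := by
    obtain ⟨s, hs⟩ := Submodule.mem_span_singleton.1 h.2
    obtain ⟨ω, hω⟩ := N.nabla_e_one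
    refine ⟨ω + d s, ?_⟩
    have : e' 1 = N.e 1 + s • N.e 0 := by rw [hs]; abel
    rw [this, map_add, N.nabla.leibniz, N.nabla_e_zero, hω, h.1, TensorProduct.tmul_add]
    simp

end Connections

section Pullback

variable {A B B' R Ω Ω' : Type u} [CommRing A] [CommRing B] [CommRing B'] [CommRing R]
  [Algebra B A] [Algebra B' R]
  [AddCommGroup Ω] [Module B Ω] [Module A Ω] [AddCommGroup Ω'] [Module B' Ω'] [Module R Ω']

theorem one_tmul_smul [Algebra A R] {M : Type u} [AddCommGroup M] [Module A M] (a : A) (m : M) :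
    (1 : R) ⊗ₜ[A] (a • m) = algebraMap A R a • ((1 : R) ⊗ₜ[A] m) := by
  rw [TensorProduct.tmul_smul, algebraMap_smul]

/-- The map `M ⊗ Ω → (R ⊗ M) ⊗ Ω'`, `m ⊗ ω ↦ (1 ⊗ m) ⊗ δ ω`. -/
def pullbackForms [Algebra A R] (δ : Ω →ₛₗ[algebraMap A R] Ω') (M : Type u) [AddCommGroup M]
    [Module A M] : M ⊗[A] Ω →+ (R ⊗[A] M) ⊗[R] Ω' :=
  TensorProduct.liftAddHom
    (AddMonoidHom.mk' (fun m : M => AddMonoidHom.mk'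
        (fun ω : Ω => ((1 : R) ⊗ₜ[A] m) ⊗ₜ[R] δ ω)
        (by intro a b; rw [map_add, TensorProduct.tmul_add]))
      (by intro a b; ext ω; simp [TensorProduct.tmul_add, TensorProduct.add_tmul]))
    (by
      intro a m ω
      simp only [AddMonoidHom.mk'_apply, LinearMap.map_smulₛₗ]
      rw [one_tmul_smul, TensorProduct.smul_tmul])

theorem pullbackForms_tmul [Algebra A R] (δ : Ω →ₛₗ[algebraMap A R] Ω') (M : Type u)
    [AddCommGroup M] [Module A M] (m : M) (ω : Ω) :
    pullbackForms δ M (m ⊗ₜ[A] ω) = ((1 : R) ⊗ₜ[A] m) ⊗ₜ[R] δ ω := rfl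

theorem pullbackForms_smul [Algebra A R] (δ : Ω →ₛₗ[algebraMap A R] Ω') (M : Type u)
    [AddCommGroup M] [Module A M] (a : A) (t : M ⊗[A] Ω) :
    pullbackForms δ M (a • t) = algebraMap A R a • pullbackForms δ M t := by
  induction t using TensorProduct.induction_on with
  | zero => simp
  | tmul m ω =>
    rw [← TensorProduct.tmul_smul, pullbackForms_tmul, pullbackForms_tmul, LinearMap.map_smulₛₗ,
      TensorProduct.tmul_smul]
  | add x y hx hy => rw [smul_add, map_add, map_add, hx, hy, smul_add]

/-- The biadditive map `(s, m) ↦ (1 ⊗ m) ⊗ ds + s · δ(∇ m)`. -/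
def Connection.pullbackAux [Algebra A R] {d : Derivation B A Ω} (d' : Derivation B' R Ω')
    (δ : Ω →ₛₗ[algebraMap A R] Ω') {M : Type u} [AddCommGroup M] [Module A M]
    (nabla : Connection d M) : R →+ M →+ (R ⊗[A] M) ⊗[R] Ω' :=
  AddMonoidHom.mk' (fun s : R => AddMonoidHom.mk'
      (fun m : M => ((1 : R) ⊗ₜ[A] m) ⊗ₜ[R] d' s + s • pullbackForms δ M (nabla m)) (by
        intro a b
        rw [map_add, map_add, TensorProduct.tmul_add, TensorProduct.add_tmul, smul_add]
        abel)) (by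
    intro a b
    refine AddMonoidHom.ext fun m => ?_
    rw [AddMonoidHom.add_apply, AddMonoidHom.mk'_apply, AddMonoidHom.mk'_apply,
      AddMonoidHom.mk'_apply, map_add, TensorProduct.tmul_add, add_smul]
    abel)

theorem Connection.pullbackAux_apply [Algebra A R] {d : Derivation B A Ω}
    (d' : Derivation B' R Ω') (δ : Ω →ₛₗ[algebraMap A R] Ω') {M : Type u} [AddCommGroup M]
    [Module A M] (nabla : Connection d M) (s : R) (m : M) :
    nabla.pullbackAux d' δ s m
      = ((1 : R) ⊗ₜ[A] m) ⊗ₜ[R] d' s + s • pullbackForms δ M (nabla m) := rfl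

/-- The pull-back of a connection along `A → R`, where `δ : Ω → Ω'` is the induced map on
differentials: the connection on `R ⊗ M` with `∇ (s ⊗ m) = (1 ⊗ m) ⊗ ds + s · δ(∇ m)`. -/
def Connection.pullback [Algebra A R] {d : Derivation B A Ω} (d' : Derivation B' R Ω')
    (δ : Ω →ₛₗ[algebraMap A R] Ω') (hδ : ∀ a, δ (d a) = d' (algebraMap A R a))
    {M : Type u} [AddCommGroup M] [Module A M] (nabla : Connection d M) :
    Connection d' (R ⊗[A] M) where
  toFun := TensorProduct.liftAddHom (nabla.pullbackAux d' δ) (by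
    intro a s m
    rw [Connection.pullbackAux_apply, Connection.pullbackAux_apply, nabla.leibniz, map_add,
      pullbackForms_smul, pullbackForms_tmul, hδ, Algebra.smul_def, Derivation.leibniz,
      TensorProduct.tmul_add, TensorProduct.tmul_smul, TensorProduct.tmul_smul, one_tmul_smul,
      ← TensorProduct.smul_tmul', smul_add, smul_smul, mul_comm s]
    abel)
  leibniz := by
    intro c t
    induction t using TensorProduct.induction_on with
    | zero => simp
    | tmul s m =>
      rw [TensorProduct.smul_tmul', TensorProduct.liftAddHom_tmul, TensorProduct.liftAddHom_tmul,
        Connection.pullbackAux_apply, Connection.pullbackAux_apply]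
      have : s ⊗ₜ[A] m = s • ((1 : R) ⊗ₜ[A] m) := by
        rw [TensorProduct.smul_tmul', smul_eq_mul, mul_one]
      rw [this, smul_eq_mul, Derivation.leibniz, TensorProduct.tmul_add, TensorProduct.tmul_smul,
        TensorProduct.tmul_smul, smul_add, mul_smul, ← TensorProduct.smul_tmul']
      abel
    | add x y hx hy =>
      rw [smul_add, map_add, hx, hy, map_add, TensorProduct.add_tmul, smul_add]
      abel

theorem Connection.pullback_tmul [Algebra A R] {d : Derivation B A Ω} (d' : Derivation B' R Ω')
    (δ : Ω →ₛₗ[algebraMap A R] Ω') (hδ : ∀ a, δ (d a) = d' (algebraMap A R a))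
    {M : Type u} [AddCommGroup M] [Module A M] (nabla : Connection d M) (s : R) (m : M) :
    nabla.pullback d' δ hδ (s ⊗ₜ[A] m)
      = ((1 : R) ⊗ₜ[A] m) ⊗ₜ[R] d' s + s • pullbackForms δ M (nabla m) := rfl

/-- The pull-back of a framed `∇`-module along a ring homomorphism `f : A → R` with induced map `δ`
on differentials, with the frame `1 ⊗ e 0, 1 ⊗ e 1`. -/
def FramedModule.pullback {d : Derivation B A Ω} (N : FramedModule d) (d' : Derivation B' R Ω')
    (f : A →+* R) (δ : Ω →ₛₗ[f] Ω') (hδ : ∀ a, δ (d a) = d' (f a)) : FramedModule d' :=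
  letI : Algebra A R := f.toAlgebra
  { M := R ⊗[A] N.M
    nabla := N.nabla.pullback d' δ hδ
    e := N.e.baseChange R
    nabla_e_zero := by
      rw [Module.Basis.baseChange_apply, Connection.pullback_tmul, N.nabla_e_zero]
      simp
    nabla_e_one := by
      obtain ⟨ω, hω⟩ := N.nabla_e_one
      refine ⟨δ ω, ?_⟩
      rw [Module.Basis.baseChange_apply, Connection.pullback_tmul, hω, Module.Basis.baseChange_apply,
        pullbackForms_tmul]
      simp }

end Pullback

section Unipotent

/-- The group `U_{(1,1)}(R)` of upper triangular unipotent `2 × 2` matrices. -/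
def U (R : Type u) [CommRing R] : Subgroup (GL (Fin 2) R) where
  carrier := {g | g 0 0 = 1 ∧ g 1 0 = 0 ∧ g 1 1 = 1}
  one_mem' := by simp
  mul_mem' := by
    rintro a b ⟨h1, h2, h3⟩ ⟨h4, h5, h6⟩
    simp [Matrix.mul_apply, *]
  inv_mem' := by
    rintro a ⟨h1, h2, h3⟩
    have hd : (a : Matrix (Fin 2) (Fin 2) R).det = 1 := by
      rw [Matrix.det_fin_two, h1, h2, h3]; simp
    simp [Matrix.coe_units_inv, Matrix.inv_def, hd, Matrix.adjugate_fin_two, h1, h2, h3]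

/-- The homomorphism `U(R) → U(S)` induced by a ring homomorphism `R → S`. -/
def U.map {R S : Type u} [CommRing R] [CommRing S] (f : R →+* S) : U R →* U S :=
  ((Matrix.GeneralLinearGroup.map f).comp (U R).subtype).codRestrict (U S) (by
    rintro ⟨g, h1, h2, h3⟩
    refine ⟨?_, ?_, ?_⟩
    · simpa using congrArg f h1
    · simpa using congrArg f h2
    · simpa using congrArg f h3)

end Unipotent
section Rings

variable (p : ℕ) [Fact p.Prime] (k : Type u) [Field k] [CharP k p] [PerfectRing k p]

/-- The ring `𝓞` of Witt vectors of `k`. -/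
abbrev O : Type u := WittVector p k

/-- The fraction field of `𝓞`. -/
abbrev K : Type u := FractionRing (O p k)

/-- The ring `Γ₊ = 𝓞[[u]]`. -/
abbrev GammaPlus : Type u := PowerSeries (O p k)

/-- The inclusion `𝓞[[u]] → K[[u]]`. -/
def gammaToK : GammaPlus p k →+* PowerSeries (K p k) :=
  PowerSeries.map (algebraMap (O p k) (K p k))

variable {p k}

open Classical in
/-- The `p`-adic valuation of `K`, normalised by `v_p(p) = 1`, with `v_p(0) = ∞`. -/
def vp (x : K p k) : EReal :=
  if x = 0 then ⊤ else
    ((-(WithZero.log ((IsDiscreteValuationRing.maximalIdeal (O p k)).valuation (K p k) x)) : ℤ) : ℝ)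

theorem vp_zero : vp (0 : K p k) = ⊤ := if_pos rfl

theorem vp_ne_bot (x : K p k) : vp x ≠ ⊥ := by
  unfold vp; split_ifs <;> simp

theorem vp_mul (x y : K p k) : vp (x * y) = vp x + vp y := by
  by_cases hx : x = 0
  · simp [hx, vp_zero, EReal.top_add_of_ne_bot (vp_ne_bot y)]
  by_cases hy : y = 0
  · simp [hy, vp_zero, EReal.add_top_of_ne_bot (vp_ne_bot x)]
  simp only [vp, hx, hy, mul_eq_zero, or_self, if_false, map_mul]
  rw [WithZero.log_mul (by simpa using hx) (by simpa using hy)]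
  norm_cast
  ring_nf

theorem min_le_vp_add (x y : K p k) : min (vp x) (vp y) ≤ vp (x + y) := by
  by_cases hx : x = 0
  · simp [hx]
  by_cases hy : y = 0
  · simp [hy]
  by_cases hxy : x + y = 0
  · simp [hxy, vp_zero]
  have h := Valuation.map_add ((IsDiscreteValuationRing.maximalIdeal (O p k)).valuation (K p k)) x y
  simp only [vp, hx, hy, hxy, if_false]
  rw [le_max_iff] at h
  rw [min_le_iff]
  refine h.imp (fun h => ?_) (fun h => ?_)
  · rw [← WithZero.log_le_log (by simpa using hxy) (by simpa using hx)] at h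
    exact_mod_cast neg_le_neg h
  · rw [← WithZero.log_le_log (by simpa using hxy) (by simpa using hy)] at h
    exact_mod_cast neg_le_neg h

theorem vp_algebraMap_nonneg (a : O p k) : 0 ≤ vp (algebraMap (O p k) (K p k) a) := by
  by_cases h : algebraMap (O p k) (K p k) a = 0
  · simp [h, vp_zero]
  have h1 := (IsDiscreteValuationRing.maximalIdeal (O p k)).valuation_le_one (K := K p k) a
  rw [vp, if_neg h]
  rw [← WithZero.log_le_log (by simpa using h) one_ne_zero, WithZero.log_one] at h1
  exact_mod_cast neg_nonneg.2 h1

theorem vp_p : vp ((p : ℕ) : K p k) = 1 := by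
  have hp0 : ((p : ℕ) : O p k) ≠ 0 := (WittVector.irreducible p (k := k)).ne_zero
  have h : (algebraMap (O p k) (K p k)) ((p : ℕ) : O p k) = ((p : ℕ) : K p k) := by simp
  have h0 : ((p : ℕ) : K p k) ≠ 0 := by
    rw [← h]; exact (map_ne_zero_iff _ (IsFractionRing.injective (O p k) (K p k))).2 hp0
  have h1 := (IsDiscreteValuationRing.maximalIdeal (O p k)).intValuation_singleton hp0
    (WittVector.irreducible p (k := k)).maximalIdeal_eq
  rw [← IsDedekindDomain.HeightOneSpectrum.valuation_of_algebraMap (K := K p k)] at h1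
  rw [vp, if_neg h0, ← h, h1]
  simp

theorem vp_one : vp (1 : K p k) = 0 := by
  simp [vp]

theorem vp_p_pow (n : ℕ) : vp (((p : ℕ) : K p k) ^ n) = ((n : ℝ) : EReal) := by
  induction n with
  | zero => simp [vp_one]
  | succ n ih => rw [pow_succ, vp_mul, ih, vp_p]; push_cast; rfl

theorem le_vp_add {r : EReal} {x y : K p k} (hx : r ≤ vp x) (hy : r ≤ vp y) : r ≤ vp (x + y) :=
  (le_min hx hy).trans (min_le_vp_add x y)

theorem le_vp_sum {ι : Type*} (s : Finset ι) (f : ι → K p k) {r : EReal}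
    (h : ∀ i ∈ s, r ≤ vp (f i)) : r ≤ vp (∑ i ∈ s, f i) := by
  classical
  induction s using Finset.induction_on with
  | empty => simp [vp_zero]
  | insert a s ha ih =>
    rw [Finset.sum_insert ha]
    exact le_vp_add (h a (Finset.mem_insert_self a s))
      (ih fun i hi => h i (Finset.mem_insert_of_mem hi))

theorem le_vp_mul {r s : ℝ} {x y : K p k} (hx : (r : EReal) ≤ vp x) (hy : (s : EReal) ≤ vp y) :
    ((r + s : ℝ) : EReal) ≤ vp (x * y) := by
  rw [vp_mul, EReal.coe_add]
  exact add_le_add hx hy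

/-- The valuation of a positive integer. -/
theorem exists_vp_natCast (n : ℕ) (hn : n ≠ 0) :
    ∃ a : ℕ, a ≤ Nat.log p n ∧ vp ((n : ℕ) : K p k) = ((a : ℝ) : EReal) ∧ ((n : ℕ) : K p k) ≠ 0 := by
  obtain ⟨a, m, hm, rfl⟩ := Nat.exists_eq_pow_mul_and_not_dvd hn p (Fact.out : p.Prime).ne_one
  have hu : IsUnit ((m : ℕ) : O p k) := by
    apply WittVector.isUnit_of_coeff_zero_ne_zero
    have : ((m : ℕ) : O p k).coeff 0 = ((m : ℕ) : k) := map_natCast (WittVector.constantCoeff) m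
    rw [this]
    exact fun h => hm ((CharP.cast_eq_zero_iff k p m).1 h)
  obtain ⟨w, hw⟩ := hu
  have hm1 : ((m : ℕ) : K p k) = algebraMap (O p k) (K p k) w := by rw [hw]; simp
  have hvm : vp ((m : ℕ) : K p k) = 0 := by
    have h1 : 0 ≤ vp ((m : ℕ) : K p k) := hm1 ▸ vp_algebraMap_nonneg _
    have h2 : 0 ≤ vp (algebraMap (O p k) (K p k) ((w⁻¹ : (O p k)ˣ) : O p k)) :=
      vp_algebraMap_nonneg _
    have h3 : vp ((m : ℕ) : K p k) + vp (algebraMap (O p k) (K p k) ((w⁻¹ : (O p k)ˣ) : O p k))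
        = 0 := by
      rw [← vp_mul, hm1, ← map_mul, Units.mul_inv, map_one, vp_one]
    refine le_antisymm ?_ h1
    rw [← h3]
    exact le_add_of_nonneg_right h2
  have hv : vp (((p ^ a * m : ℕ)) : K p k) = ((a : ℝ) : EReal) := by
    rw [Nat.cast_mul, Nat.cast_pow, vp_mul, vp_p_pow, hvm, add_zero]
  refine ⟨a, ?_, hv, ?_⟩
  · apply Nat.le_log_of_pow_le (Fact.out : p.Prime).one_lt
    exact Nat.le_mul_of_pos_right _ (Nat.pos_of_ne_zero fun h => hm (h ▸ dvd_zero p))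
  · intro h
    rw [h, vp_zero] at hv
    exact EReal.coe_ne_top _ hv.symm

/-- The growth condition `liminf_{i → ∞} v_p(x_i) / i ≥ 0`. -/
def Growth (f : PowerSeries (K p k)) : Prop :=
  0 ≤ Filter.liminf (fun i : ℕ => vp (PowerSeries.coeff i f) / (i : EReal)) Filter.atTop

theorem growth_iff (f : PowerSeries (K p k)) : Growth f ↔
    ∀ ε : ℝ, 0 < ε → ∃ C : ℝ, 0 ≤ C ∧
      ∀ i : ℕ, ((-ε * i - C : ℝ) : EReal) ≤ vp (PowerSeries.coeff i f) := by
  have key : Growth f ↔ ∀ ε : ℝ, 0 < ε →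
      ∀ᶠ i : ℕ in Filter.atTop, ((-ε * i : ℝ) : EReal) ≤ vp (PowerSeries.coeff i f) := by
    have aux : ∀ (y : ℝ) (i : ℕ), 0 < i → (((y : ℝ) : EReal) ≤ vp (PowerSeries.coeff i f) / (i : EReal)
        ↔ ((y * i : ℝ) : EReal) ≤ vp (PowerSeries.coeff i f)) := by
      intro y i hi
      rw [EReal.le_div_iff_mul_le (by exact_mod_cast hi) (by exact EReal.natCast_ne_top i)]
      push_cast
      rfl
    unfold Growth
    rw [Filter.le_liminf_iff]
    constructor
    · intro h ε hε
      filter_upwards [h ((-ε : ℝ) : EReal) (by exact_mod_cast neg_lt_zero.2 hε),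
        Filter.eventually_gt_atTop 0] with i hi hi0
      exact (aux _ i hi0).1 hi.le
    · intro h y hy
      obtain ⟨z, hyz, hz0⟩ := EReal.lt_iff_exists_real_btwn.1 hy
      have hz0' : z < 0 := by exact_mod_cast hz0
      filter_upwards [h (-z) (by linarith), Filter.eventually_gt_atTop 0] with i hi hi0
      rw [neg_neg] at hi
      exact hyz.trans_le ((aux _ i hi0).2 hi)
  rw [key]
  constructor
  · intro h ε hε
    obtain ⟨N, hN⟩ := Filter.eventually_atTop.1 (h ε hε)
    have hb : ∀ i : ℕ, ∃ c : ℝ, 0 ≤ c ∧ ((-c : ℝ) : EReal) ≤ vp (PowerSeries.coeff i f) := by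
      intro i
      by_cases h0 : PowerSeries.coeff i f = 0
      · exact ⟨0, le_rfl, by rw [h0, vp_zero]; exact le_top⟩
      · rw [vp, if_neg h0]
        refine ⟨|((-(WithZero.log ((IsDiscreteValuationRing.maximalIdeal (O p k)).valuation (K p k)
          (PowerSeries.coeff i f))) : ℤ) : ℝ)|, abs_nonneg _, ?_⟩
        exact EReal.coe_le_coe_iff.2 (neg_abs_le _)
    choose c hc0 hc using hb
    refine ⟨∑ i ∈ Finset.range N, c i, Finset.sum_nonneg fun i _ => hc0 i, fun i => ?_⟩
    have hS : 0 ≤ ∑ i ∈ Finset.range N, c i := Finset.sum_nonneg fun i _ => hc0 i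
    have hεi : 0 ≤ ε * i := by positivity
    by_cases hi : N ≤ i
    · refine le_trans (EReal.coe_le_coe_iff.2 ?_) (hN i hi)
      linarith
    · refine le_trans (EReal.coe_le_coe_iff.2 ?_) (hc i)
      have := Finset.single_le_sum (f := c) (fun i _ => hc0 i)
        (Finset.mem_range.2 (not_le.1 hi))
      linarith
  · intro h ε hε
    obtain ⟨C, hC0, hC⟩ := h (ε / 2) (by linarith)
    obtain ⟨N, hN⟩ := exists_nat_ge (2 * C / ε)
    filter_upwards [Filter.eventually_ge_atTop N] with i hi
    refine le_trans (EReal.coe_le_coe_iff.2 ?_) (hC i)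
    have h1 : 2 * C / ε ≤ i := hN.trans (by exact_mod_cast hi)
    rw [div_le_iff₀ hε] at h1
    linarith

theorem growth_of_bounded (f : PowerSeries (K p k)) (C : ℝ)
    (h : ∀ i, ((-C : ℝ) : EReal) ≤ vp (PowerSeries.coeff i f)) : Growth f := by
  rw [growth_iff]
  intro ε hε
  refine ⟨|C|, abs_nonneg C, fun i => le_trans (EReal.coe_le_coe_iff.2 ?_) (h i)⟩
  have hεi : 0 ≤ ε * i := by positivity
  have := le_abs_self C
  linarith

theorem vp_bdd_below (x : K p k) : ∃ C : ℝ, ((-C : ℝ) : EReal) ≤ vp x := by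
  by_cases h0 : x = 0
  · exact ⟨0, by rw [h0, vp_zero]; exact le_top⟩
  · rw [vp, if_neg h0]
    exact ⟨-((-(WithZero.log ((IsDiscreteValuationRing.maximalIdeal (O p k)).valuation (K p k)
      x)) : ℤ) : ℝ), by rw [neg_neg]⟩

variable (p k)

/-- The ring `𝓔₊ = Γ₊[1/p]`, as a subring of `K[[u]]`. -/
def ePlus : Subalgebra (K p k) (PowerSeries (K p k)) where
  carrier := {f | ∃ (n : ℕ) (g : GammaPlus p k), PowerSeries.C ((p : K p k) ^ n) * f = gammaToK p k g}
  mul_mem' := by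
    rintro a b ⟨n, g, hg⟩ ⟨m, h, hh⟩
    refine ⟨n + m, g * h, ?_⟩
    rw [map_mul, ← hg, ← hh, pow_add, map_mul]
    ring
  add_mem' := by
    rintro a b ⟨n, g, hg⟩ ⟨m, h, hh⟩
    refine ⟨n + m, PowerSeries.C ((p : O p k) ^ m) * g + PowerSeries.C ((p : O p k) ^ n) * h, ?_⟩
    rw [map_add, map_mul, map_mul, ← hg, ← hh, pow_add, map_mul]
    simp only [gammaToK, map_pow, map_natCast]
    ring
  algebraMap_mem' := by
    intro c
    obtain ⟨a, b, hb, rfl⟩ := IsFractionRing.div_surjective (A := O p k) c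
    obtain ⟨n, w, hw⟩ := WittVector.exists_eq_pow_p_mul' b (nonZeroDivisors.ne_zero hb)
    refine ⟨n, PowerSeries.C (a * ((w⁻¹ : (O p k)ˣ) : O p k)), ?_⟩
    have hp0 : algebraMap (O p k) (K p k) ((p : ℕ) : O p k) ≠ 0 :=
      (map_ne_zero_iff _ (IsFractionRing.injective (O p k) (K p k))).2
        (WittVector.irreducible p (k := k)).ne_zero
    have hw0 : algebraMap (O p k) (K p k) (w : O p k) ≠ 0 := by simp
    have hwi : algebraMap (O p k) (K p k) ((w⁻¹ : (O p k)ˣ) : O p k)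
        = (algebraMap (O p k) (K p k) (w : O p k))⁻¹ := by
      rw [← mul_eq_one_iff_eq_inv₀ hw0, ← map_mul, Units.inv_mul, map_one]
    have key : (p : K p k) ^ n * (algebraMap (O p k) (K p k) a / algebraMap (O p k) (K p k) b)
        = algebraMap (O p k) (K p k) a * (algebraMap (O p k) (K p k) (w : O p k))⁻¹ := by
      rw [hw, map_mul, map_pow]
      rw [map_natCast] at hp0 ⊢
      field_simp
    rw [gammaToK, PowerSeries.map_C, map_mul, hwi, ← key]
    exact (map_mul PowerSeries.C _ _).symm

/-- The ring `𝓡₊` of power series over `K` with `liminf_{i → ∞} v_p(x_i) / i ≥ 0`. -/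
def rPlus : Subalgebra (K p k) (PowerSeries (K p k)) where
  carrier := {f | Growth f}
  mul_mem' := by
    intro a b ha hb
    rw [Set.mem_ofPred_eq, growth_iff] at *
    intro ε hε
    obtain ⟨C, hC0, hC⟩ := ha ε hε
    obtain ⟨D, hD0, hD⟩ := hb ε hε
    refine ⟨C + D, add_nonneg hC0 hD0, fun i => ?_⟩
    rw [PowerSeries.coeff_mul]
    refine le_vp_sum _ _ fun x hx => ?_
    rw [Finset.HasAntidiagonal.mem_antidiagonal] at hx
    refine le_trans (EReal.coe_le_coe_iff.2 (le_of_eq ?_)) (le_vp_mul (hC x.1) (hD x.2))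
    rw [← hx]
    push_cast
    ring
  add_mem' := by
    intro a b ha hb
    rw [Set.mem_ofPred_eq, growth_iff] at *
    intro ε hε
    obtain ⟨C, hC0, hC⟩ := ha ε hε
    obtain ⟨D, hD0, hD⟩ := hb ε hε
    refine ⟨C + D, add_nonneg hC0 hD0, fun i => ?_⟩
    rw [map_add]
    refine le_vp_add (le_trans (EReal.coe_le_coe_iff.2 ?_) (hC i))
      (le_trans (EReal.coe_le_coe_iff.2 ?_) (hD i)) <;> linarith
  algebraMap_mem' := by
    intro c
    obtain ⟨C, hC⟩ := vp_bdd_below c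
    refine growth_of_bounded _ |C| fun i => ?_
    change _ ≤ vp (PowerSeries.coeff i (PowerSeries.C c))
    rw [PowerSeries.coeff_C]
    split_ifs
    · exact le_trans (EReal.coe_le_coe_iff.2 (neg_le_neg (le_abs_self C))) hC
    · rw [vp_zero]; exact le_top

theorem ePlus_le_rPlus : ePlus p k ≤ rPlus p k := by
  rintro f ⟨n, g, hg⟩
  refine growth_of_bounded _ n fun i => ?_
  have h := congrArg (fun f => vp (PowerSeries.coeff i f)) hg
  simp only [PowerSeries.coeff_C_mul, vp_mul, vp_p_pow, gammaToK, PowerSeries.coeff_map] at h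
  have h0 := vp_algebraMap_nonneg (PowerSeries.coeff i g)
  rw [← h] at h0
  generalize vp (PowerSeries.coeff i f) = y at h0
  induction y with
  | bot => simp at h0
  | top => exact le_top
  | coe y =>
    have h0' : ((0 : ℝ) : EReal) ≤ ((n + y : ℝ) : EReal) := h0
    rw [EReal.coe_le_coe_iff] at h0' ⊢
    linarith

/-- `𝓔₊` as a type. -/
abbrev EPlus : Type u := ↥(ePlus p k)

/-- `𝓡₊` as a type. -/
abbrev RPlus : Type u := ↥(rPlus p k)

/-- The inclusion `Γ₊ → 𝓔₊`. -/
def gammaToE : GammaPlus p k →+* EPlus p k :=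
  (gammaToK p k).codRestrict (ePlus p k) fun g => ⟨0, g, by simp⟩

/-- The inclusion `𝓔₊ → 𝓡₊`. -/
def eToR : EPlus p k →ₐ[K p k] RPlus p k :=
  Subalgebra.inclusion (ePlus_le_rPlus p k)

theorem derivative_gammaToK (g : GammaPlus p k) :
    PowerSeries.derivative (K p k) (gammaToK p k g)
      = gammaToK p k (PowerSeries.derivative (O p k) g) := by
  ext i
  simp [gammaToK, PowerSeries.coeff_derivative]

theorem derivative_mem_ePlus {f : PowerSeries (K p k)} (hf : f ∈ ePlus p k) :
    PowerSeries.derivative (K p k) f ∈ ePlus p k := by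
  obtain ⟨n, g, hg⟩ := hf
  refine ⟨n, PowerSeries.derivative (O p k) g, ?_⟩
  rw [← derivative_gammaToK, ← hg, Derivation.leibniz, PowerSeries.derivative_C]
  simp

theorem derivative_mem_rPlus {f : PowerSeries (K p k)} (hf : f ∈ rPlus p k) :
    PowerSeries.derivative (K p k) f ∈ rPlus p k := by
  change Growth f at hf
  change Growth _
  rw [growth_iff] at *
  intro ε hε
  obtain ⟨C, hC0, hC⟩ := hf ε hε
  refine ⟨C + ε, by positivity, fun i => ?_⟩
  rw [PowerSeries.coeff_derivative]
  have h1 : ((0 : ℝ) : EReal) ≤ vp ((i : K p k) + 1) := by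
    have := vp_algebraMap_nonneg ((i : O p k) + 1)
    simpa using this
  refine le_trans (EReal.coe_le_coe_iff.2 (le_of_eq ?_)) (le_vp_mul (hC (i + 1)) h1)
  push_cast
  ring

/-- The differential of `Γ₊`, where `Ω¹` is the free module generated by `du`, identified
with `Γ₊`. -/
abbrev dGamma : Derivation (O p k) (GammaPlus p k) (GammaPlus p k) :=
  PowerSeries.derivative (O p k)

/-- The restriction of `d/du` to a subalgebra of `K[[u]]` that it preserves. -/
def restrictDerivative (S : Subalgebra (K p k) (PowerSeries (K p k)))
    (hS : ∀ f ∈ S, PowerSeries.derivative (K p k) f ∈ S) : Derivation (K p k) S S :=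
  Derivation.mk'
    (((PowerSeries.derivative (K p k)).toLinearMap.comp S.val.toLinearMap).codRestrict
      (Subalgebra.toSubmodule S) fun f => hS f f.2)
    (by
      intro a b
      apply Subtype.ext
      change PowerSeries.derivative (K p k) ((a : PowerSeries (K p k)) * b)
        = a * PowerSeries.derivative (K p k) (b : PowerSeries (K p k))
          + b * PowerSeries.derivative (K p k) (a : PowerSeries (K p k))
      rw [Derivation.leibniz]
      rfl)

/-- The differential of `𝓔₊`, where `Ω¹` is the free module generated by `du`, identified
with `𝓔₊`. -/
def dE : Derivation (K p k) (EPlus p k) (EPlus p k) :=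
  restrictDerivative p k (ePlus p k) fun _ => derivative_mem_ePlus p k

/-- The differential of `𝓡₊`, where `Ω¹` is the free module generated by `du`, identified
with `𝓡₊`. -/
def dR : Derivation (K p k) (RPlus p k) (RPlus p k) :=
  restrictDerivative p k (rPlus p k) fun _ => derivative_mem_rPlus p k

theorem coe_dE (f : EPlus p k) :
    (dE p k f : PowerSeries (K p k)) = PowerSeries.derivative (K p k) (f : PowerSeries (K p k)) :=
  rfl

theorem coe_dR (f : RPlus p k) :
    (dR p k f : PowerSeries (K p k)) = PowerSeries.derivative (K p k) (f : PowerSeries (K p k)) :=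
  rfl

theorem dE_gammaToE (g : GammaPlus p k) : gammaToE p k (dGamma p k g) = dE p k (gammaToE p k g) :=
  Subtype.ext (derivative_gammaToK p k g).symm

theorem dR_eToR (f : EPlus p k) : eToR p k (dE p k f) = dR p k (eToR p k f) := rfl

/-- Every differential form over `𝓡₊` is exact. -/
theorem exists_dR_eq (f : RPlus p k) : ∃ w : RPlus p k, dR p k w = f := by
  obtain ⟨f, hf⟩ := f
  let g : PowerSeries (K p k) := PowerSeries.mk fun i =>
    if i = 0 then 0 else PowerSeries.coeff (i - 1) f * ((i : ℕ) : K p k)⁻¹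
  have hlog : ∀ ε : ℝ, 0 < ε → ∃ C : ℝ, 0 ≤ C ∧ ∀ i : ℕ, (Nat.log p i : ℝ) ≤ ε * i + C := by
    intro ε hε
    have ho : (fun i : ℕ => Real.log i) =o[Filter.atTop] fun i : ℕ => (i : ℝ) :=
      Real.isLittleO_log_id_atTop.comp_tendsto tendsto_natCast_atTop_atTop
    have hl2 : 0 < Real.log 2 := Real.log_pos (by norm_num)
    obtain ⟨N, hN⟩ := Filter.eventually_atTop.1 (ho.bound (mul_pos hε hl2))
    have key : ∀ i : ℕ, (Nat.log p i : ℝ) * Real.log 2 ≤ Real.log i := by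
      intro i
      rcases Nat.eq_zero_or_pos i with rfl | hi
      · simp
      have h1 : 2 ^ Nat.log p i ≤ i :=
        (Nat.pow_le_pow_left (Fact.out : p.Prime).two_le _).trans (Nat.pow_log_le_self p hi.ne')
      have h2 : ((2 : ℝ) ^ Nat.log p i) ≤ i := by exact_mod_cast h1
      have := Real.log_le_log (by positivity) h2
      rwa [Real.log_pow] at this
    refine ⟨N, Nat.cast_nonneg N, fun i => ?_⟩
    have hεi : 0 ≤ ε * i := by positivity
    by_cases hi : N ≤ i
    · have h1 := hN i hi
      rw [Real.norm_eq_abs, Real.norm_eq_abs, Nat.abs_cast] at h1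
      have h2 := (key i).trans ((le_abs_self _).trans h1)
      have h3 : (Nat.log p i : ℝ) ≤ ε * i := by
        refine le_of_mul_le_mul_right ?_ hl2
        linarith
      have : (0 : ℝ) ≤ N := Nat.cast_nonneg N
      linarith
    · have h1 : (Nat.log p i : ℝ) ≤ i := by exact_mod_cast Nat.log_le_self p i
      have h2 : (i : ℝ) ≤ N := by exact_mod_cast (not_le.1 hi).le
      linarith
  have hg : g ∈ rPlus p k := by
    change Growth f at hf
    change Growth g
    rw [growth_iff] at *
    intro ε hε
    obtain ⟨C, hC0, hC⟩ := hf (ε / 2) (by linarith)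
    obtain ⟨D, hD0, hD⟩ := hlog (ε / 2) (by linarith)
    refine ⟨C + D, by positivity, fun i => ?_⟩
    rw [PowerSeries.coeff_mk]
    split_ifs with hi
    · rw [vp_zero]; exact le_top
    obtain ⟨a, ha, hva, hne⟩ := exists_vp_natCast (p := p) (k := k) i hi
    have hinv : ((-(a : ℝ) : ℝ) : EReal) ≤ vp ((i : ℕ) : K p k)⁻¹ := by
      have h1 : vp ((i : ℕ) : K p k) + vp ((i : ℕ) : K p k)⁻¹ = 0 := by
        rw [← vp_mul, mul_inv_cancel₀ hne, vp_one]
      rw [hva] at h1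
      generalize vp ((i : ℕ) : K p k)⁻¹ = y at h1
      induction y with
      | bot => simp at h1
      | top => exact le_top
      | coe y =>
        have h1' : ((a + y : ℝ) : EReal) = ((0 : ℝ) : EReal) := h1
        rw [EReal.coe_eq_coe_iff] at h1'
        rw [EReal.coe_le_coe_iff]
        linarith
    refine le_trans (EReal.coe_le_coe_iff.2 ?_) (le_vp_mul (hC (i - 1)) hinv)
    have h1 := hD i
    have h2 : (a : ℝ) ≤ Nat.log p i := by exact_mod_cast ha
    have h3 : ((i - 1 : ℕ) : ℝ) ≤ i := by exact_mod_cast Nat.sub_le i 1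
    have h4 : ε / 2 * ((i - 1 : ℕ) : ℝ) ≤ ε / 2 * i := by gcongr
    linarith
  refine ⟨⟨g, hg⟩, Subtype.ext ?_⟩
  rw [coe_dR]
  ext i
  obtain ⟨a, ha, hva, hne⟩ := exists_vp_natCast (p := p) (k := k) (i + 1) (Nat.succ_ne_zero i)
  rw [PowerSeries.coeff_derivative, PowerSeries.coeff_mk, if_neg (Nat.succ_ne_zero i)]
  push_cast at hne ⊢
  rw [mul_assoc, inv_mul_cancel₀ hne, mul_one]

end Rings
section FormalScheme

variable (p : ℕ) [Fact p.Prime] (k : Type u) [Field k] [CharP k p] [PerfectRing k p]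

/-- The ring `𝓞[[u, x]]`, written as `𝓞[[u]][[x]]`. -/
abbrev OX : Type u := PowerSeries (GammaPlus p k)

/-- The partial derivative `∂/∂u` on `𝓞[[u, x]]`, coefficientwise in `x`. -/
def partialU : OX p k →ₗ[O p k] OX p k where
  toFun f := PowerSeries.mk fun j => dGamma p k (PowerSeries.coeff j f)
  map_add' f g := by
    ext1 j
    simp only [PowerSeries.coeff_mk, map_add]
  map_smul' c f := by
    ext1 j
    have h : PowerSeries.coeff j (c • f) = c • PowerSeries.coeff j f := rfl
    have h' : ∀ g : OX p k, PowerSeries.coeff j (c • g) = c • PowerSeries.coeff j g := fun _ => rfl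
    rw [PowerSeries.coeff_mk, h, Derivation.map_smul, RingHom.id_apply, h', PowerSeries.coeff_mk]

theorem coeff_partialU (f : OX p k) (j : ℕ) :
    PowerSeries.coeff j (partialU p k f) = dGamma p k (PowerSeries.coeff j f) :=
  PowerSeries.coeff_mk j fun j => dGamma p k (PowerSeries.coeff j f)

theorem partialU_mul (f g : OX p k) :
    partialU p k (f * g) = f * partialU p k g + g * partialU p k f := by
  ext1 j
  rw [coeff_partialU, PowerSeries.coeff_mul, map_sum, map_add, mul_comm g, PowerSeries.coeff_mul,
    PowerSeries.coeff_mul, ← Finset.sum_add_distrib]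
  refine Finset.sum_congr rfl fun x _ => ?_
  rw [Derivation.leibniz, coeff_partialU, coeff_partialU, smul_eq_mul, smul_eq_mul,
    mul_comm (PowerSeries.coeff x.2 g)]

/-- The partial derivative `∂/∂x` on `𝓞[[u, x]]`. -/
def partialX : OX p k →ₗ[O p k] OX p k where
  toFun f := PowerSeries.derivative (GammaPlus p k) f
  map_add' f g := map_add _ f g
  map_smul' c f := by
    ext1 j
    have h : ∀ (i : ℕ) (g : OX p k), PowerSeries.coeff i (c • g) = c • PowerSeries.coeff i g :=
      fun _ _ => rfl
    rw [RingHom.id_apply, h, PowerSeries.coeff_derivative, PowerSeries.coeff_derivative, h,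
      smul_mul_assoc]

theorem partialX_apply (f : OX p k) : partialX p k f = PowerSeries.derivative (GammaPlus p k) f :=
  rfl

theorem partialX_mul (f g : OX p k) :
    partialX p k (f * g) = f * partialX p k g + g * partialX p k f := by
  simp only [partialX_apply, Derivation.leibniz, smul_eq_mul]

/-- The differential of `𝓞[[u, x]]`, where `Ω¹` is the free module generated by `du, dx`,
identified with the pairs of coefficients: `d f = (∂f/∂u) du + (∂f/∂x) dx`. -/
def dOX : Derivation (O p k) (OX p k) (OX p k × OX p k) :=
  Derivation.mk' ((partialU p k).prod (partialX p k)) (by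
    intro a b
    exact Prod.ext (partialU_mul p k a b) (partialX_mul p k a b))

theorem dOX_apply (f : OX p k) : dOX p k f = (partialU p k f, partialX p k f) := rfl

/-- The ideal of definition `(p, u)` of `Γ₊ = 𝓞[[u]]`. -/
def idealGamma : Ideal (GammaPlus p k) :=
  Ideal.span {(p : GammaPlus p k), PowerSeries.X}

/-- The ideal of definition `(p, u, x)` of `𝓞[[u, x]]`. -/
def idealOX : Ideal (OX p k) :=
  Ideal.span {(p : OX p k), PowerSeries.C PowerSeries.X, PowerSeries.X}

/-- The set `X(Γ₊)` of sections of `X = Spf 𝓞[[u, x]] → Spf 𝓞[[u]]`: the continuous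
`𝓞[[u]]`-algebra homomorphisms `𝓞[[u, x]] → 𝓞[[u]]`, where `𝓞[[u]] → 𝓞[[u, x]]` is the inclusion
`PowerSeries.C` as power series constant in `x`. -/
structure Sections where
  ψ : OX p k →+* GammaPlus p k
  map_C : ∀ c : GammaPlus p k, ψ (PowerSeries.C c) = c
  continuous : @Continuous _ _ (idealOX p k).adicTopology (idealGamma p k).adicTopology ψ

variable {p k}

theorem not_isUnit_map_X (ψ : OX p k →+* GammaPlus p k)
    (hC : ∀ c : GammaPlus p k, ψ (PowerSeries.C c) = c) :
    ¬ IsUnit (ψ PowerSeries.X) := by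
  rintro ⟨c, hc⟩
  have hu : IsUnit (1 - PowerSeries.C ((c⁻¹ : (GammaPlus p k)ˣ) : GammaPlus p k) * PowerSeries.X :
      OX p k) := by
    rw [PowerSeries.isUnit_iff_constantCoeff]
    simp
  have h := hu.map ψ
  rw [map_sub, map_mul, hC, ← hc, map_one, Units.inv_mul, sub_self] at h
  exact not_isUnit_zero h

/-- The chain rule `d(ψ f) = ψ(∂f/∂u) du + ψ(∂f/∂x) d(ψ x)`. -/
theorem chain_rule (ψ : OX p k →+* GammaPlus p k)
    (hC : ∀ c : GammaPlus p k, ψ (PowerSeries.C c) = c) (f : OX p k) :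
    ψ (partialU p k f) + ψ (partialX p k f) * dGamma p k (ψ PowerSeries.X)
      = dGamma p k (ψ f) := by
  let D : OX p k → GammaPlus p k := fun f => dGamma p k (ψ f)
    - (ψ (partialU p k f) + ψ (partialX p k f) * dGamma p k (ψ PowerSeries.X))
  have hD : ∀ f, D f = dGamma p k (ψ f)
    - (ψ (partialU p k f) + ψ (partialX p k f) * dGamma p k (ψ PowerSeries.X)) := fun _ => rfl
  have hadd : ∀ f g, D (f + g) = D f + D g := by
    intro f g; simp only [hD, map_add]; ring
  have hmul : ∀ f g, D (f * g) = ψ f * D g + ψ g * D f := by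
    intro f g
    simp only [hD, map_mul, partialU_mul, partialX_mul, map_add, Derivation.leibniz, smul_eq_mul]
    ring
  have hDC : ∀ c : GammaPlus p k, D (PowerSeries.C c) = 0 := by
    intro c
    have h1 : partialU p k (PowerSeries.C c) = PowerSeries.C (dGamma p k c) := by
      ext1 j
      rw [coeff_partialU, PowerSeries.coeff_C, PowerSeries.coeff_C]
      split_ifs
      · rfl
      · exact map_zero _
    rw [hD, h1, hC, hC, partialX_apply, PowerSeries.derivative_C, map_zero, zero_mul, add_zero, sub_self]
  have hDX : D PowerSeries.X = 0 := by
    have h1 : partialU p k PowerSeries.X = 0 := by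
      ext1 j
      rw [coeff_partialU, PowerSeries.coeff_X]
      split_ifs
      · exact Derivation.map_one_eq_zero _
      · simp
    rw [hD, h1, partialX_apply, PowerSeries.derivative_X, map_zero, map_one, zero_add, one_mul, sub_self]
  have hDXn : ∀ n : ℕ, D (PowerSeries.X ^ n) = 0 := by
    intro n
    induction n with
    | zero =>
      have := hDC 1
      rwa [map_one] at this
    | succ n ih => rw [pow_succ, hmul, ih, hDX, mul_zero, mul_zero, add_zero]
  have hsum : ∀ (s : Finset ℕ) (g : ℕ → OX p k), (∀ i ∈ s, D (g i) = 0) →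
      D (∑ i ∈ s, g i) = 0 := by
    intro s g hg
    classical
    induction s using Finset.induction_on with
    | empty => simpa using hDC 0
    | insert a s ha ih =>
      rw [Finset.sum_insert ha, hadd, hg a (Finset.mem_insert_self a s),
        ih fun i hi => hg i (Finset.mem_insert_of_mem hi), add_zero]
  have hpow : ∀ n : ℕ, D f ∈ Ideal.span {ψ PowerSeries.X} ^ n := by
    intro n
    let t : OX p k := ∑ i ∈ Finset.range n, PowerSeries.C (PowerSeries.coeff i f) * PowerSeries.X ^ i
    have ht : D t = 0 := by
      refine hsum _ _ fun i _ => ?_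
      rw [hmul, hDXn, hDC, mul_zero, mul_zero, add_zero]
    obtain ⟨g, hg⟩ : (PowerSeries.X : OX p k) ^ n ∣ f - t := by
      rw [PowerSeries.X_pow_dvd_iff]
      intro m hm
      simp only [t, map_sub, map_sum, PowerSeries.coeff_C_mul, PowerSeries.coeff_X_pow]
      simp [hm]
    have hf : f = t + PowerSeries.X ^ n * g := by rw [← hg]; ring
    rw [hf, hadd, ht, zero_add, hmul, hDXn, mul_zero, add_zero, map_pow, Ideal.span_singleton_pow]
    exact Ideal.mul_mem_right _ _ (Ideal.mem_span_singleton_self _)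
  have hbot : D f ∈ (⊥ : Ideal (GammaPlus p k)) := by
    rw [← Ideal.iInf_pow_eq_bot_of_isLocalRing (Ideal.span {ψ PowerSeries.X})
      (by rw [Ne, Ideal.span_singleton_eq_top]; exact not_isUnit_map_X ψ hC)]
    exact (Submodule.mem_iInf _).2 hpow
  have h0 : D f = 0 := hbot
  rw [hD, sub_eq_zero] at h0
  exact h0.symm

/-- The map on differentials induced by a section `ψ`: `du ↦ du` and `dx ↦ d(ψ x)`. -/
def Sections.mapForms (ψ : Sections p k) :
    (OX p k × OX p k) →ₛₗ[ψ.ψ] GammaPlus p k where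
  toFun w := ψ.ψ w.1 + ψ.ψ w.2 * dGamma p k (ψ.ψ PowerSeries.X)
  map_add' a b := by
    simp only [Prod.fst_add, Prod.snd_add, map_add]; ring
  map_smul' c a := by
    simp only [Prod.smul_fst, Prod.smul_snd, smul_eq_mul, map_mul]; ring

/-- The pull-back of a framed `∇`-module on `X = Spf 𝓞[[u, x]]` along a section. -/
def FramedModule.pullbackSection (N : FramedModule (dOX p k)) (ψ : Sections p k) :
    FramedModule (dGamma p k) :=
  N.pullback (dGamma p k) ψ.ψ ψ.mapForms (chain_rule ψ.ψ ψ.map_C)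

/-- The base change `· ⊗ 𝓔₊` of a framed `∇`-module over `Γ₊`. -/
def FramedModule.toE (N : FramedModule (dGamma p k)) : FramedModule (dE p k) :=
  N.pullback (dE p k) (gammaToE p k) (gammaToE p k).toSemilinearMap (dE_gammaToE p k)

/-- The base change `· ⊗ 𝓡₊` of a framed `∇`-module over `𝓔₊`. -/
def FramedModule.toR (N : FramedModule (dE p k)) : FramedModule (dR p k) :=
  N.pullback (dR p k) (eToR p k : EPlus p k →+* RPlus p k)
    (eToR p k : EPlus p k →+* RPlus p k).toSemilinearMap (dR_eToR p k)

variable (p k)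

/-- The subgroup `U(𝓔₊)` of `U(𝓡₊)`. -/
def UE : Subgroup (U (RPlus p k)) := (U.map (eToR p k : EPlus p k →+* RPlus p k)).range

/-- The subgroup `U(K)` of `U(𝓡₊)`. -/
def UK : Subgroup (U (RPlus p k)) := (U.map (algebraMap (K p k) (RPlus p k))).range

/-- The set of double cosets `U(𝓔₊) \ U(𝓡₊) / U(K)`. -/
abbrev Cosets : Type u :=
  DoubleCoset.Quotient (UE p k : Set (U (RPlus p k))) (UK p k : Set (U (RPlus p k)))

/-- The quotient group `𝓔₊ \ 𝓡₊`. -/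
abbrev RModE : Type u := RPlus p k ⧸ LinearMap.range (eToR p k).toLinearMap

variable {p k}

/-- `c` is the invariant of `N`: for a compatible frame `e'` of `N` and a trivialization `φ` of
`N ⊗ 𝓡₊`, it is the double coset of the matrix of `φ` in the basis `e' ⊗ 1`. -/
def FramedModule.HasInvariant (N : FramedModule (dE p k)) (c : Cosets p k) : Prop :=
  ∃ (e' : Module.Basis (Fin 2) (EPlus p k) N.M) (h : N.Compatible e')
    (φ : (N.reframe e' h).toR.Trivialization) (V : U (RPlus p k)),
    ((V : GL (Fin 2) (RPlus p k)) : Matrix (Fin 2) (Fin 2) (RPlus p k))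
        = LinearMap.toMatrix (N.reframe e' h).toR.e (Pi.basisFun (RPlus p k) (Fin 2))
            φ.φ.toLinearMap ∧
      c = DoubleCoset.mk (UE p k) (UK p k) V

/-- The invariant of a framed `∇`-module over `𝓔₊`. -/
def FramedModule.invariant (N : FramedModule (dE p k)) : Cosets p k :=
  Classical.epsilon N.HasInvariant

/-- The line integral of a framed `∇`-module on `X = Spf 𝓞[[u, x]]`. -/
def lineIntegral (N : FramedModule (dOX p k)) (ψ : Sections p k) : Cosets p k :=
  (N.pullbackSection ψ).toE.invariant

variable (p k)

/-- The framed `∇`-module on `X = Spf 𝓞[[u, x]]` with `∇ e₁ = 0` and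
`∇ e₂ = e₁ ⊗ dx / (1 + x)`, where `(1 + x)⁻¹ = ∑ (-1)^i x^i`. -/
def logModule : FramedModule (dOX p k) :=
  dlogModule (dOX p k) (0, PowerSeries.mk fun i => (-1) ^ i)

variable {p k}

/-- The form `dv / v` for a unit `v` of `Γ₊`. -/
def dlog (v : (GammaPlus p k)ˣ) : GammaPlus p k :=
  ((v⁻¹ : (GammaPlus p k)ˣ) : GammaPlus p k) * dGamma p k v

/-- Reduction modulo `p` of units, from `𝓞[[u]]` to `k[[t]]`. -/
def reduction : (GammaPlus p k)ˣ →* (PowerSeries k)ˣ :=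
  Units.map (PowerSeries.map (WittVector.constantCoeff (p := p) (R := k))).toMonoidHom

theorem reduction_surjective (v : (PowerSeries k)ˣ) :
    ∃ y : (GammaPlus p k)ˣ, reduction y = v := by
  obtain ⟨g, hg⟩ := PowerSeries.map_surjective (WittVector.constantCoeff (p := p) (R := k))
    (fun a => ⟨WittVector.teichmuller p a, WittVector.teichmuller_coeff_zero p a⟩)
    (v : PowerSeries k)
  have hu : IsUnit g := by
    have h1 := v.isUnit
    rw [← hg, PowerSeries.isUnit_iff_constantCoeff] at h1
    rw [PowerSeries.isUnit_iff_constantCoeff]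
    apply WittVector.isUnit_of_coeff_zero_ne_zero
    have h2 := h1.ne_zero
    rw [← PowerSeries.coeff_zero_eq_constantCoeff_apply, PowerSeries.coeff_map] at h2
    rwa [← PowerSeries.coeff_zero_eq_constantCoeff_apply]
  exact ⟨hu.unit, Units.ext hg⟩

theorem exists_logDagger (v : (PowerSeries k)ˣ) : ∃ w : RPlus p k, ∃ y : (GammaPlus p k)ˣ,
    reduction y = v ∧ dR p k w = eToR p k (gammaToE p k (dlog y)) := by
  obtain ⟨y, hy⟩ := reduction_surjective (p := p) v
  obtain ⟨w, hw⟩ := exists_dR_eq p k (eToR p k (gammaToE p k (dlog y)))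
  exact ⟨w, y, hy, hw⟩

/-- The `p`-adic logarithm `log† : k[[t]]* → 𝓡₊ / 𝓔₊`: the class of `w ∈ 𝓡₊` with
`dw = dy / y` for a lift `y ∈ Γ₊*` of the argument. -/
def logDagger (v : (PowerSeries k)ˣ) : RModE p k :=
  Submodule.Quotient.mk (exists_logDagger (p := p) v).choose

end FormalScheme

end

end PadicLineIntegral

open PadicLineIntegral

/-! A framed module of signature (1,1) amounts to one differential form: the `ω` with `∇ e₂ = e₁ ⊗
ω`. Replacing `e₂` by `e₂ + s e₁` changes `ω` by `ds`, base change replaces `ω` by its image, and a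
trivialization is the same thing as a primitive `w` of `ω`, placed in the upper right entry. That
entry identifies the unipotent group with the additive group, and `K ⊆ 𝓔₊`, so the double cosets are
just `𝓡₊` modulo `𝓔₊`. The invariant is therefore the class of any primitive of `ω`
(`FramedModule.hasInvariant_iff`). It exists because every form over `𝓡₊` is exact, and it is unique
because the constants of integration and the changes of frame both lie in `𝓔₊`.

For `ω = dv/v` this class is `log†` of the reduction of `v`, provided that the choice of lift does
not matter. Two lifts differ by a factor `z = 1 + p g`, and `dz/z` must be exact over `Γ₊`
(`exists_dGamma_eq_dlog`). A primitive is `log z = ∑ (-1)^n p^(n+1) g^(n+1) / (n+1)`, which is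
integral because `n + 1` divides `p^(n+1)`. The proof replaces convergence of this series by finite
expansions whose remainder is `p`-adically small enough for one coefficient at a time.

A section is determined by the image of `x`, which is a non-unit of the local ring `Γ₊` and hence
lies in `(p, u)`. Krull's intersection theorem gives injectivity, and `(p, u)`-adic completeness of
`Γ₊` gives evaluation at any element of `(p, u)`. Pulling back `dx/(1+x)` gives `dv/v` with `v =
ψ(1+x)`. -/

namespace PadicLineIntegral

/-! ### Framed modules and their connection form -/

section FramedModules

variable {B R Ω : Type u} [CommRing B] [CommRing R] [Algebra B R] [AddCommGroup Ω] [Module B Ω]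
  [Module R Ω] {d : Derivation B R Ω}

theorem FramedModule.eq_smul_add_smul (N : FramedModule d) (m : N.M) :
    m = N.e.repr m 0 • N.e 0 + N.e.repr m 1 • N.e 1 := by
  conv_lhs => rw [← N.e.sum_repr m, Fin.sum_univ_two]

/-- A linear map into a module with a connection is horizontal if it is so on a basis. -/
theorem FramedModule.horizontal_of_basis (N : FramedModule d) {M' : Type u} [AddCommGroup M']
    [Module R M'] (nabla' : Connection d M') (f : N.M →ₗ[R] M')
    (h : ∀ i, nabla' (f (N.e i)) = f.rTensor Ω (N.nabla (N.e i))) (m : N.M) :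
    nabla' (f m) = f.rTensor Ω (N.nabla m) := by
  rw [N.eq_smul_add_smul m]
  simp only [map_add, map_smul, nabla'.leibniz, N.nabla.leibniz, h, LinearMap.rTensor_tmul]

/-- The linear map matching the frames is horizontal because both connections have the same matrix
in them. The form `ω` is thus a complete invariant of the frame. -/
theorem FramedModule.iso_of_nabla_eq (N N' : FramedModule d) {ω : Ω}
    (h : N.nabla (N.e 1) = N.e 0 ⊗ₜ[R] ω) (h' : N'.nabla (N'.e 1) = N'.e 0 ⊗ₜ[R] ω) :
    N.Iso N' := by
  have he : ∀ i, N.e.equiv N'.e (Equiv.refl _) (N.e i) = N'.e i := fun i => by simp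
  refine ⟨N.e.equiv N'.e (Equiv.refl _), N.horizontal_of_basis N'.nabla
    (N.e.equiv N'.e (Equiv.refl _)).toLinearMap fun i => ?_, he⟩
  fin_cases i
  · simp [N.nabla_e_zero, N'.nabla_e_zero]
  · simp [h, h']

theorem trivialConnection_smul_add (w : R) :
    trivialConnection d (Pi.single 1 1 + w • Pi.single 0 1) = Pi.single 0 1 ⊗ₜ[R] d w := by
  rw [trivialConnection_apply, Fin.sum_univ_two]
  simp

theorem trivialConnection_single (i : Fin 2) :
    trivialConnection d (Pi.single i 1) = 0 := by
  rw [trivialConnection_apply, Fin.sum_univ_two]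
  fin_cases i <;> simp

/-- A primitive of the connection form gives a trivialization. -/
theorem FramedModule.exists_trivialization (N : FramedModule d) {ω : Ω}
    (h : N.nabla (N.e 1) = N.e 0 ⊗ₜ[R] ω) {w : R} (hw : d w = ω) :
    ∃ φ : N.Trivialization, φ.φ (N.e 1) = Pi.single 1 1 + w • Pi.single 0 1 := by
  let f := N.e.constr R ![(Pi.single 0 1 : Fin 2 → R), Pi.single 1 1 + w • Pi.single 0 1]
  -- The matrix of `f` is unipotent with upper right entry `w`, so its inverse has entry `-w`.
  let g := (Pi.basisFun R (Fin 2)).constr R ![N.e 0, N.e 1 - w • N.e 0]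
  have hf0 : f (N.e 0) = Pi.single 0 1 := by simp [f]
  have hf1 : f (N.e 1) = Pi.single 1 1 + w • Pi.single 0 1 := by simp [f]
  have hg0 : g (Pi.single 0 1) = N.e 0 := by
    rw [← Pi.basisFun_apply, Module.Basis.constr_basis]; rfl
  have hg1 : g (Pi.single 1 1) = N.e 1 - w • N.e 0 := by
    rw [← Pi.basisFun_apply, Module.Basis.constr_basis]; rfl
  have hgf : g ∘ₗ f = LinearMap.id := N.e.ext fun i => by
    fin_cases i
    · simp [hf0, hg0]
    · simp [hf1, hg0, hg1]
  have hfg : f ∘ₗ g = LinearMap.id := (Pi.basisFun R (Fin 2)).ext fun i => by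
    fin_cases i
    · simp [hf0, hg0]
    · simp [hf0, hf1, hg1]
  refine ⟨⟨LinearEquiv.ofLinearMap f g hfg hgf, N.horizontal_of_basis _ f fun i => ?_, hf0, ?_⟩, hf1⟩
  · fin_cases i
    · change trivialConnection d (f (N.e 0)) = f.rTensor Ω (N.nabla (N.e 0))
      rw [hf0, trivialConnection_single, N.nabla_e_zero, map_zero]
    · change trivialConnection d (f (N.e 1)) = f.rTensor Ω (N.nabla (N.e 1))
      rw [hf1, trivialConnection_smul_add, h, LinearMap.rTensor_tmul, hf0, hw]
  · exact Submodule.mem_span_singleton.2 ⟨w, by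
      change _ = f (N.e 1) - _
      rw [hf1, add_sub_cancel_left]⟩

/-- The upper right entry of a trivialization is a primitive of the connection form. -/
theorem FramedModule.Trivialization.d_apply_zero {N : FramedModule d} (φ : N.Trivialization) {ω : Ω}
    (h : N.nabla (N.e 1) = N.e 0 ⊗ₜ[R] ω) : d (φ.φ (N.e 1) 0) = ω := by
  obtain ⟨w, hw⟩ := Submodule.mem_span_singleton.1 φ.map_e_one
  have h1 : φ.φ (N.e 1) = Pi.single 1 1 + w • Pi.single 0 1 := by rw [hw]; abel
  have h2 := φ.horizontal (N.e 1)
  rw [h, LinearMap.rTensor_tmul, h1, trivialConnection_smul_add, LinearEquiv.coe_coe,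
    φ.map_e_zero] at h2
  -- Horizontality now reads `e₁ ⊗ dw = e₁ ⊗ ω`. The first coordinate functional, applied to the
  -- left factor, cancels `e₁`.
  have h3 := congrArg (fun t => TensorProduct.lid R Ω
    ((LinearMap.proj (0 : Fin 2) : (Fin 2 → R) →ₗ[R] R).rTensor Ω t)) h2
  simpa [h1] using h3

theorem dlogModule_nabla_e_one (ω : Ω) : (dlogModule d ω).nabla ((dlogModule d ω).e 1)
    = (dlogModule d ω).e 0 ⊗ₜ[R] ω := by
  change dlogConnection d ω (Pi.basisFun R (Fin 2) 1) = Pi.basisFun R (Fin 2) 0 ⊗ₜ[R] ω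
  simp [dlogConnection]

/-- By the Leibniz rule, adding `s e₁` to `e₂` adds `ds` to the form. This exact term is why the
invariant can only be defined modulo `𝓔₊`. -/
theorem FramedModule.reframe_nabla_e_one (N : FramedModule d) {ω : Ω}
    (hω : N.nabla (N.e 1) = N.e 0 ⊗ₜ[R] ω) (e' : Module.Basis (Fin 2) R N.M)
    (h : N.Compatible e') :
    ∃ s : R, (N.reframe e' h).nabla ((N.reframe e' h).e 1)
      = (N.reframe e' h).e 0 ⊗ₜ[R] (ω + d s) := by
  obtain ⟨s, hs⟩ := Submodule.mem_span_singleton.1 h.2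
  refine ⟨s, ?_⟩
  change N.nabla (e' 1) = e' 0 ⊗ₜ[R] (ω + d s)
  have : e' 1 = N.e 1 + s • N.e 0 := by rw [hs]; abel
  rw [this, map_add, N.nabla.leibniz, N.nabla_e_zero, hω, h.1, TensorProduct.tmul_add]
  simp

end FramedModules

/-- Since `d 1 = 0`, only the term coming from `∇ e₂` survives on `1 ⊗ e₂`. The structure of a
framed module merely asserts that some form exists. The explicit one is needed along `ψ`, along `Γ₊
→ 𝓔₊` and along `𝓔₊ → 𝓡₊`. -/
theorem FramedModule.pullback_nabla_e_one {A B B' R Ω Ω' : Type u} [CommRing A] [CommRing B]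
    [CommRing B'] [CommRing R] [Algebra B A] [Algebra B' R]
    [AddCommGroup Ω] [Module B Ω] [Module A Ω] [AddCommGroup Ω'] [Module B' Ω'] [Module R Ω']
    {d : Derivation B A Ω} (N : FramedModule d) (d' : Derivation B' R Ω')
    (f : A →+* R) (δ : Ω →ₛₗ[f] Ω') (hδ : ∀ a, δ (d a) = d' (f a)) {ω : Ω}
    (hω : N.nabla (N.e 1) = N.e 0 ⊗ₜ[A] ω) :
    (N.pullback d' f δ hδ).nabla ((N.pullback d' f δ hδ).e 1)
      = (N.pullback d' f δ hδ).e 0 ⊗ₜ[R] δ ω := by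
  let : Algebra A R := f.toAlgebra
  change N.nabla.pullback d' δ hδ (N.e.baseChange R 1) = N.e.baseChange R 0 ⊗ₜ[R] δ ω
  rw [Module.Basis.baseChange_apply, Connection.pullback_tmul, hω, Module.Basis.baseChange_apply,
    pullbackForms_tmul]
  simp

end PadicLineIntegral

namespace PadicLineIntegral

/-! ### Unipotent matrices as an additive group -/

section Unipotent

variable {R : Type u} [CommRing R]

/-- The unipotent matrix with upper right entry `w`. -/
def U.mk (w : R) : U R where
  val :=
    { val := !![1, w; 0, 1]
      inv := !![1, -w; 0, 1]
      val_inv := by simp [Matrix.one_fin_two]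
      inv_val := by simp [Matrix.one_fin_two] }
  property := ⟨rfl, rfl, rfl⟩

theorem U.mk_apply_zero_one (w : R) : (U.mk w : GL (Fin 2) R) 0 1 = w := rfl

theorem U.ext_zero_one {V W : U R} (h : (V : GL (Fin 2) R) 0 1 = (W : GL (Fin 2) R) 0 1) :
    V = W := by
  obtain ⟨h1, h2, h3⟩ := V.2
  obtain ⟨h4, h5, h6⟩ := W.2
  refine Subtype.ext (Units.ext (Matrix.ext fun i j => ?_))
  fin_cases i <;> fin_cases j
  exacts [h1.trans h4.symm, h, h2.trans h5.symm, h3.trans h6.symm]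

theorem U.mul_apply_zero_one (V W : U R) : ((V * W : U R) : GL (Fin 2) R) 0 1
    = (V : GL (Fin 2) R) 0 1 + (W : GL (Fin 2) R) 0 1 := by
  have h1 : (V : GL (Fin 2) R) 0 0 = 1 := V.2.1
  have h2 : (W : GL (Fin 2) R) 1 1 = 1 := W.2.2.2
  rw [Subgroup.coe_mul, Units.val_mul, Matrix.mul_apply, Fin.sum_univ_two, h1, h2, one_mul,
    mul_one, add_comm]

theorem U.map_apply_zero_one {S : Type u} [CommRing S] (f : R →+* S) (V : U R) :
    (U.map f V : GL (Fin 2) S) 0 1 = f ((V : GL (Fin 2) R) 0 1) := rfl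

end Unipotent

/-! ### Double cosets and the invariant -/

section Cosets

variable {p : ℕ} [Fact p.Prime] {k : Type u} [Field k] [CharP k p] [PerfectRing k p]

/-- Multiplication adds upper right entries, so the double coset of an entry `w` is `w + 𝓔₊ + K`,
which is `w + 𝓔₊` because `K ⊆ 𝓔₊`. -/
theorem cosets_mk_eq_iff (V W : U (RPlus p k)) :
    DoubleCoset.mk (UE p k) (UK p k) V = DoubleCoset.mk (UE p k) (UK p k) W ↔
      (Submodule.Quotient.mk ((V : GL (Fin 2) (RPlus p k)) 0 1) : RModE p k)
        = Submodule.Quotient.mk ((W : GL (Fin 2) (RPlus p k)) 0 1) := by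
  rw [DoubleCoset.eq, Submodule.Quotient.eq']
  constructor
  · rintro ⟨_, ⟨a, rfl⟩, _, ⟨b, rfl⟩, rfl⟩
    -- The group is commutative, so the constant from the right factor can be absorbed into the left
    -- one.
    refine ⟨(a : GL (Fin 2) (EPlus p k)) 0 1
      + algebraMap (K p k) (EPlus p k) ((b : GL (Fin 2) (K p k)) 0 1), ?_⟩
    rw [U.mul_apply_zero_one, U.mul_apply_zero_one, U.map_apply_zero_one, U.map_apply_zero_one,
      AlgHom.toLinearMap_apply, map_add, AlgHom.commutes, RingHom.coe_coe]
    abel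
  · rintro ⟨s, hs⟩
    refine ⟨_, ⟨U.mk s, rfl⟩, 1, one_mem _, U.ext_zero_one ?_⟩
    rw [mul_one, U.mul_apply_zero_one, U.map_apply_zero_one, U.mk_apply_zero_one]
    rw [AlgHom.toLinearMap_apply] at hs
    rw [RingHom.coe_coe, hs]
    abel

variable (p k) in
/-- The upper right entry identifies the double cosets with `𝓔₊ \ 𝓡₊`. -/
noncomputable def cosetsEquiv : Cosets p k ≃ RModE p k :=
  Equiv.ofBijective
    (Quotient.lift (fun V => Submodule.Quotient.mk ((V : GL (Fin 2) (RPlus p k)) 0 1))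
      fun V W h => (cosets_mk_eq_iff V W).1 (Quotient.sound h))
    (by
      constructor
      · intro a b
        refine Quotient.inductionOn₂ a b fun V W h => (cosets_mk_eq_iff V W).2 h
      · intro x
        obtain ⟨w, rfl⟩ := Submodule.Quotient.mk_surjective _ x
        exact ⟨DoubleCoset.mk (UE p k) (UK p k) (U.mk w), rfl⟩)

theorem cosetsEquiv_mk (V : U (RPlus p k)) :
    cosetsEquiv p k (DoubleCoset.mk (UE p k) (UK p k) V)
      = Submodule.Quotient.mk ((V : GL (Fin 2) (RPlus p k)) 0 1) := rfl

/-- The kernel of the differential of `𝓡₊` consists of the constants. -/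
theorem mem_range_eToR_of_dR_eq_zero {w : RPlus p k} (h : dR p k w = 0) :
    w ∈ LinearMap.range (eToR p k).toLinearMap := by
  have hw : (w : PowerSeries (K p k))
      = PowerSeries.C (PowerSeries.constantCoeff (w : PowerSeries (K p k))) := by
    -- A series with zero derivative is constant only if the positive integers are invertible in
    -- `K`.
    have : CharZero (K p k) := charZero_of_inj_zero fun n hn => by
      by_contra h0
      obtain ⟨_, _, _, h1⟩ := exists_vp_natCast (p := p) (k := k) n h0
      exact h1 hn
    refine PowerSeries.derivative.ext ?_ (by simp)
    rw [PowerSeries.derivative_C, ← coe_dR, h]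
    rfl
  refine ⟨algebraMap (K p k) (EPlus p k) (PowerSeries.constantCoeff (w : PowerSeries (K p k))), ?_⟩
  rw [AlgHom.toLinearMap_apply, AlgHom.commutes]
  exact Subtype.ext hw.symm

/-- `w - w' - s` has zero derivative, hence is a constant and lies in `𝓔₊`. This one argument
removes the constant of integration together with the choice of frame or of lift. -/
theorem mk_eq_mk_of_dR_sub {w w' : RPlus p k} {s : EPlus p k}
    (h : dR p k w = dR p k w' + eToR p k (dE p k s)) :
    (Submodule.Quotient.mk w : RModE p k) = Submodule.Quotient.mk w' := by
  rw [Submodule.Quotient.eq]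
  have h1 : w - w' - eToR p k s ∈ LinearMap.range (eToR p k).toLinearMap :=
    mem_range_eToR_of_dR_eq_zero (by rw [map_sub, map_sub, h, dR_eToR]; abel)
  have h2 : eToR p k s ∈ LinearMap.range (eToR p k).toLinearMap := ⟨s, rfl⟩
  simpa using add_mem h1 h2

theorem FramedModule.toR_nabla_e_one (N : FramedModule (dE p k)) {ω : EPlus p k}
    (h : N.nabla (N.e 1) = N.e 0 ⊗ₜ[EPlus p k] ω) :
    N.toR.nabla (N.toR.e 1) = N.toR.e 0 ⊗ₜ[RPlus p k] eToR p k ω :=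
  N.pullback_nabla_e_one _ _ _ _ h

/-- The invariant is the class of the primitives of the connection form. -/
theorem FramedModule.hasInvariant_iff (N : FramedModule (dE p k)) {ω : EPlus p k}
    (h : N.nabla (N.e 1) = N.e 0 ⊗ₜ[EPlus p k] ω) {w : RPlus p k} (hw : dR p k w = eToR p k ω)
    (c : Cosets p k) : N.HasInvariant c ↔ cosetsEquiv p k c = Submodule.Quotient.mk w := by
  constructor
  · rintro ⟨e', he', φ, V, hV, rfl⟩
    obtain ⟨s, hs⟩ := N.reframe_nabla_e_one h e' he'
    have h1 := φ.d_apply_zero ((N.reframe e' he').toR_nabla_e_one hs)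
    have h2 : (V : GL (Fin 2) (RPlus p k)) 0 1 = φ.φ ((N.reframe e' he').toR.e 1) 0 := by
      rw [hV, LinearMap.toMatrix_apply]
      simp
    rw [cosetsEquiv_mk, h2]
    exact mk_eq_mk_of_dR_sub (by rw [h1, hw, map_add])
  · intro hc
    -- The given frame already realizes the class, with the trivialization built from the primitive
    -- `w`.
    have he : N.Compatible N.e := ⟨rfl, by simp⟩
    obtain ⟨φ, hφ⟩ := (N.reframe N.e he).toR.exists_trivialization
      ((N.reframe N.e he).toR_nabla_e_one h) hw
    refine ⟨N.e, he, φ, U.mk w, ?_, ?_⟩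
    · have h0 := φ.map_e_zero
      refine Matrix.ext fun i j => ?_
      rw [LinearMap.toMatrix_apply, LinearEquiv.coe_coe]
      fin_cases j
      · change _ = (Pi.basisFun _ (Fin 2)).repr (φ.φ ((N.reframe N.e he).toR.e 0)) i
        rw [h0]
        fin_cases i <;> simp [U.mk]
      · change _ = (Pi.basisFun _ (Fin 2)).repr (φ.φ ((N.reframe N.e he).toR.e 1)) i
        rw [hφ]
        fin_cases i <;> simp [U.mk]
    · exact (cosetsEquiv p k).injective hc

theorem FramedModule.existsUnique_hasInvariant (N : FramedModule (dE p k)) :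
    ∃! c, N.HasInvariant c := by
  obtain ⟨ω, h⟩ := N.nabla_e_one
  obtain ⟨w, hw⟩ := exists_dR_eq p k (eToR p k ω)
  simp only [N.hasInvariant_iff h hw]
  exact (cosetsEquiv p k).bijective.existsUnique _

theorem FramedModule.cosetsEquiv_invariant (N : FramedModule (dE p k)) {ω : EPlus p k}
    (h : N.nabla (N.e 1) = N.e 0 ⊗ₜ[EPlus p k] ω) {w : RPlus p k} (hw : dR p k w = eToR p k ω) :
    cosetsEquiv p k N.invariant = Submodule.Quotient.mk w :=
  (N.hasInvariant_iff h hw _).1 (Classical.epsilon_spec N.existsUnique_hasInvariant.exists)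

end Cosets

end PadicLineIntegral

namespace PadicLineIntegral

/-! ### Exactness of `dz/z` for `z ≡ 1` modulo `p`, and the logarithm -/

section Logarithm

variable {p : ℕ} [Fact p.Prime] {k : Type u} [Field k] [CharP k p] [PerfectRing k p]

/-- Write `n = p^a m` with `m` prime to `p`. Then `m` is a unit of the Witt vectors and `a < p^a ≤
n`. This is the integrality of `p^n / n`, the coefficients of `log(1 + p g)` up to sign. -/
theorem natCast_dvd_p_pow (n : ℕ) (hn : n ≠ 0) : ((n : ℕ) : O p k) ∣ (p : O p k) ^ n := by
  obtain ⟨a, m, hm, hnm⟩ := Nat.exists_eq_pow_mul_and_not_dvd hn p (Fact.out : p.Prime).ne_one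
  have hu : IsUnit ((m : ℕ) : O p k) := by
    apply WittVector.isUnit_of_coeff_zero_ne_zero
    have : ((m : ℕ) : O p k).coeff 0 = ((m : ℕ) : k) := map_natCast WittVector.constantCoeff m
    rw [this]
    exact fun h => hm ((CharP.cast_eq_zero_iff k p m).1 h)
  have ha : a ≤ n := by
    have h1 : p ^ a ≤ n := hnm ▸ Nat.le_mul_of_pos_right _
      (Nat.pos_of_ne_zero fun h => hm (h ▸ dvd_zero p))
    exact (Nat.lt_pow_self (Fact.out : p.Prime).one_lt).le.trans h1
  have h2 : ((n : ℕ) : O p k) = (p : O p k) ^ a * ((m : ℕ) : O p k) := by rw [hnm]; push_cast; rfl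
  rw [h2, hu.mul_right_dvd]
  exact pow_dvd_pow _ ha

/-- Termwise integration divides the coefficient of `u^i` by `i + 1`. -/
theorem exists_dGamma_eq (f : GammaPlus p k)
    (h : ∀ i, ((i + 1 : ℕ) : O p k) ∣ PowerSeries.coeff i f) : ∃ s, dGamma p k s = f := by
  choose c hc using h
  refine ⟨PowerSeries.X * PowerSeries.mk c, ?_⟩
  ext1 i
  rw [PowerSeries.coeff_derivative, PowerSeries.coeff_succ_X_mul, PowerSeries.coeff_mk, hc,
    Nat.cast_succ, mul_comm]

/-- The primitive is `p^(n+1)/(n+1) · g^(n+1)`, up to sign a term of the series for `log(1 + p g)`.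
-/
theorem p_pow_smul_mul_dGamma_exact (g : GammaPlus p k) (n : ℕ) :
    ∃ h, dGamma p k h = (p : GammaPlus p k) ^ (n + 1) * g ^ n * dGamma p k g := by
  obtain ⟨c, hc⟩ := natCast_dvd_p_pow (p := p) (k := k) (n + 1) n.succ_ne_zero
  have hc' := congrArg (PowerSeries.C : O p k →+* GammaPlus p k) hc
  simp only [map_pow, map_mul, map_natCast] at hc'
  refine ⟨PowerSeries.C c * g ^ (n + 1), ?_⟩
  rw [Derivation.leibniz, PowerSeries.derivative_C, Derivation.leibniz_pow, smul_zero, add_zero, hc',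
    Nat.add_sub_cancel]
  simp only [smul_eq_mul, nsmul_eq_mul]
  ring

/-- The finite expansion of `dz / z` for `z = 1 + p g`. -/
theorem exists_dlog_eq_dGamma_add (z : (GammaPlus p k)ˣ) {g : GammaPlus p k}
    (hz : (z : GammaPlus p k) = 1 + p * g) (n : ℕ) :
    ∃ h, dlog z = dGamma p k h + (-1) ^ n * (p : GammaPlus p k) ^ (n + 1) * g ^ n * dGamma p k g
      * ((z⁻¹ : (GammaPlus p k)ˣ) : GammaPlus p k) := by
  induction n with
  | zero =>
    have hp : dGamma p k (p : GammaPlus p k) = 0 := Derivation.map_natCast _ p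
    refine ⟨0, ?_⟩
    rw [dlog, hz, map_add, Derivation.map_one_eq_zero, Derivation.leibniz, hp, map_zero]
    simp only [smul_eq_mul]
    ring
  | succ n ih =>
    obtain ⟨h, hh⟩ := ih
    obtain ⟨h', hh'⟩ := p_pow_smul_mul_dGamma_exact g n
    -- Substituting this for `z⁻¹` in the remainder is one step of the geometric series: the summand
    -- `1` gives an exact term and the other summand the next remainder.
    have hi : ((z⁻¹ : (GammaPlus p k)ˣ) : GammaPlus p k)
        = 1 - p * g * ((z⁻¹ : (GammaPlus p k)ˣ) : GammaPlus p k) := by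
      have := z.mul_inv
      rw [hz] at this
      linear_combination this
    refine ⟨h + (-1) ^ n * h', ?_⟩
    have hd : dGamma p k ((-1) ^ n * h') = (-1) ^ n * dGamma p k h' := by
      rcases neg_one_pow_eq_or (GammaPlus p k) n with h1 | h1 <;> simp [h1]
    rw [map_add, hd, hh', hh]
    linear_combination (-1) ^ n * (p : GammaPlus p k) ^ (n + 1) * g ^ n * dGamma p k g * hi

/-- The form `dz / z` is exact over `Γ₊` if `z ≡ 1` modulo `p`. -/
theorem exists_dGamma_eq_dlog (z : (GammaPlus p k)ˣ) (hz : (p : GammaPlus p k) ∣ z - 1) :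
    ∃ s, dGamma p k s = dlog z := by
  obtain ⟨g, hg⟩ := hz
  refine exists_dGamma_eq _ fun i => ?_
  -- The length of the expansion is adapted to the coefficient. The `i`-th coefficient of a
  -- derivative is divisible by `i + 1`, and the remainder after `i` steps is divisible by
  -- `p^(i+1)`, hence by `i + 1` too.
  obtain ⟨h, hh⟩ := exists_dlog_eq_dGamma_add z (g := g) (by rw [← hg]; ring) i
  rw [hh, map_add, PowerSeries.coeff_derivative]
  refine dvd_add ⟨_, by rw [mul_comm]; push_cast; rfl⟩
    ((natCast_dvd_p_pow (i + 1) i.succ_ne_zero).trans ?_)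
  have hp : (p : GammaPlus p k) = PowerSeries.C (p : O p k) := (map_natCast PowerSeries.C p).symm
  rw [hp, mul_comm ((-1) ^ i), mul_assoc, mul_assoc, mul_assoc, ← map_pow, PowerSeries.coeff_C_mul]
  exact dvd_mul_right _ _

theorem natCast_dvd_of_forall_coeff {R : Type*} [CommRing R] {n : ℕ} {f : PowerSeries R}
    (h : ∀ i, (n : R) ∣ PowerSeries.coeff i f) : (n : PowerSeries R) ∣ f := by
  choose c hc using h
  refine ⟨PowerSeries.mk c, ?_⟩
  ext1 i
  rw [← map_natCast (PowerSeries.C : R →+* PowerSeries R), PowerSeries.coeff_C_mul,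
    PowerSeries.coeff_mk, hc]

/-- For perfect `k`, the kernel of the reduction of Witt vectors to `k` is generated by `p`; this is
applied to each coefficient. -/
theorem p_dvd_sub_one_of_reduction_eq_one {z : (GammaPlus p k)ˣ} (h : reduction z = 1) :
    (p : GammaPlus p k) ∣ z - 1 := by
  refine natCast_dvd_of_forall_coeff fun i => ?_
  rw [← Ideal.mem_span_singleton, WittVector.mem_span_p_iff_coeff_zero_eq_zero]
  have h1 : PowerSeries.map (WittVector.constantCoeff (p := p) (R := k)) (z - 1 : GammaPlus p k)
      = 0 := by
    rw [map_sub, map_one, sub_eq_zero]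
    exact congrArg Units.val h
  have h2 := congrArg (PowerSeries.coeff i) h1
  rwa [PowerSeries.coeff_map, map_zero] at h2

theorem dlog_mul (v z : (GammaPlus p k)ˣ) : dlog (v * z) = dlog v + dlog z := by
  rw [dlog, dlog, dlog, Units.val_mul, Derivation.leibniz, mul_inv, Units.val_mul, smul_eq_mul,
    smul_eq_mul]
  linear_combination (z⁻¹ : (GammaPlus p k)ˣ) * dGamma p k z * v.inv_mul
    + (v⁻¹ : (GammaPlus p k)ˣ) * dGamma p k v * z.inv_mul

/-- The logarithm is the class of the primitives of `dv / v`. -/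
theorem logDagger_reduction (v : (GammaPlus p k)ˣ) {w : RPlus p k}
    (hw : dR p k w = eToR p k (gammaToE p k (dlog v))) :
    logDagger (p := p) (reduction v) = Submodule.Quotient.mk w := by
  obtain ⟨y, hy, hd⟩ := (exists_logDagger (p := p) (reduction v)).choose_spec
  -- The lift `y` chosen by `logDagger` may differ from `v`, but the quotient reduces to `1`, so
  -- `dy/y` and `dv/v` differ by an exact form over `Γ₊`.
  have hz : reduction (v⁻¹ * y) = 1 := by rw [map_mul, map_inv, hy, inv_mul_cancel]
  obtain ⟨s, hs⟩ := exists_dGamma_eq_dlog _ (p_dvd_sub_one_of_reduction_eq_one hz)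
  refine mk_eq_mk_of_dR_sub (s := gammaToE p k s) ?_
  rw [hd, hw, ← dE_gammaToE, hs, ← map_add, ← map_add, ← dlog_mul, mul_inv_cancel_left]

theorem FramedModule.cosetsEquiv_invariant_toE (N : FramedModule (dGamma p k))
    (v : (GammaPlus p k)ˣ)
    (h : N.nabla (N.e 1) = N.e 0 ⊗ₜ[GammaPlus p k] dlog v) :
    cosetsEquiv p k N.toE.invariant = logDagger (reduction v) := by
  obtain ⟨w, hw⟩ := exists_dR_eq p k (eToR p k (gammaToE p k (dlog v)))
  rw [logDagger_reduction v hw]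
  exact N.toE.cosetsEquiv_invariant (N.pullback_nabla_e_one _ _ _ _ h) hw

/-- Since `dx = d(1 + x)`, the form `dx/(1+x)` is the logarithmic derivative of `1 + x`, and `ψ`
carries `1 + x` to `v`. -/
theorem logModule_pullbackSection_nabla_e_one (ψ : Sections p k) (v : (GammaPlus p k)ˣ)
    (hv : ψ.ψ (1 + PowerSeries.X) = (v : GammaPlus p k)) :
    ((logModule p k).pullbackSection ψ).nabla (((logModule p k).pullbackSection ψ).e 1)
      = ((logModule p k).pullbackSection ψ).e 0 ⊗ₜ[GammaPlus p k] dlog v := by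
  have h := (logModule p k).pullback_nabla_e_one (dGamma p k) ψ.ψ ψ.mapForms
    (chain_rule ψ.ψ ψ.map_C) (dlogModule_nabla_e_one _)
  refine h.trans ?_
  congr 1
  change ψ.ψ 0 + ψ.ψ (PowerSeries.mk fun i => (-1) ^ i) * dGamma p k (ψ.ψ PowerSeries.X) = dlog v
  -- The alternating series is the inverse of `1 + x`, and a ring homomorphism preserves inverses.
  have h1 : (PowerSeries.mk fun i => (-1) ^ i : OX p k) * (1 + PowerSeries.X) = 1 := by
    ext1 i
    cases i <;> simp [mul_add, PowerSeries.coeff_succ_mul_X, PowerSeries.coeff_one, pow_succ]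
  have h2 : ψ.ψ (PowerSeries.mk fun i => (-1) ^ i) = ((v⁻¹ : (GammaPlus p k)ˣ) : GammaPlus p k) := by
    rw [← Units.mul_left_inj v, Units.inv_mul, ← hv, ← map_mul, h1, map_one]
  have h3 : dGamma p k (ψ.ψ PowerSeries.X) = dGamma p k v := by
    rw [← hv, map_add, map_one, map_add, Derivation.map_one_eq_zero, zero_add]
  rw [h2, h3, map_zero, zero_add, dlog]

end Logarithm

end PadicLineIntegral

namespace PowerSeries

/-! ### Adic completeness of power series rings -/

section Completeness

variable {R : Type*} [CommRing R]

/-- Coefficient `i` of a product involves only coefficients of `f` of index at most `i`, where the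
required power of `a` is at least as large. -/
theorem coeff_mul_mem_of_forall_coeff {a : R} {n : ℕ} {f : PowerSeries R}
    (hf : ∀ i, a ^ (n - i) ∣ coeff i f) (g : PowerSeries R) (i : ℕ) :
    a ^ (n - i) ∣ coeff i (f * g) := by
  rw [coeff_mul]
  refine Finset.dvd_sum fun x hx => ?_
  have hx' := Finset.HasAntidiagonal.mem_antidiagonal.1 hx
  exact ((pow_dvd_pow a (by omega)).trans (hf x.1)).mul_right _

/-- The ideal power is generated by the monomials `a^(n-i) X^i`. Truncated subtraction encodes that
nothing is required from degree `n` on. The criterion reduces the adic topology of power series to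
that of the coefficients. -/
theorem mem_span_C_X_pow_iff (a : R) (n : ℕ) (f : PowerSeries R) :
    f ∈ Ideal.span {C a, X} ^ n ↔ ∀ i, a ^ (n - i) ∣ coeff i f := by
  constructor
  · induction n generalizing f with
    | zero => simp
    | succ n ih =>
      intro hf
      rw [pow_succ] at hf
      refine Submodule.mul_induction_on hf (fun f hf g hg i => ?_) fun f g hf hg i => ?_
      · obtain ⟨b, c, rfl⟩ := Ideal.mem_span_pair.1 hg
        rw [mul_add, ← mul_assoc, ← mul_assoc, map_add, coeff_mul_C]
        refine dvd_add ?_ ?_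
        · refine (pow_dvd_pow a (?_ : _ ≤ n - i + 1)).trans ?_
          · omega
          · rw [pow_succ]
            exact mul_dvd_mul_right (coeff_mul_mem_of_forall_coeff (ih f hf) b i) a
        · cases i with
          | zero => simp
          | succ i =>
            rw [coeff_succ_mul_X, Nat.add_sub_add_right]
            exact coeff_mul_mem_of_forall_coeff (ih f hf) c i
      · rw [map_add]
        exact dvd_add (hf i) (hg i)
  · intro h
    -- The tail is a multiple of `X^n`; each earlier term is a multiple of `a^(n-i) X^i`.
    obtain ⟨g, hg⟩ : (X : PowerSeries R) ^ n ∣ f - ∑ i ∈ Finset.range n, C (coeff i f) * X ^ i := by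
      rw [X_pow_dvd_iff]
      intro m hm
      simp [coeff_C_mul, coeff_X_pow, hm]
    rw [eq_add_of_sub_eq hg]
    have hX : (X : PowerSeries R) ∈ Ideal.span {C a, X} := Ideal.subset_span (by simp)
    have ha : (C a : PowerSeries R) ∈ Ideal.span {C a, X} := Ideal.subset_span (by simp)
    refine add_mem (Ideal.mul_mem_right _ _ (Ideal.pow_mem_pow hX n)) (sum_mem fun i hi => ?_)
    obtain ⟨c, hc⟩ := h i
    have hn : Ideal.span {C a, (X : PowerSeries R)} ^ n = _ := congrArg _
      (Nat.sub_add_cancel (Finset.mem_range.1 hi).le).symm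
    rw [hc, map_mul, map_pow, mul_right_comm]
    refine Ideal.mul_mem_right _ _ ?_
    rw [hn, pow_add]
    exact Ideal.mul_mem_mul (Ideal.pow_mem_pow ha _) (Ideal.pow_mem_pow hX _)

/-- Limits are formed coefficientwise. Congruence modulo the `n`-th power controls coefficient `i`
only modulo `a^(n-i)`, so its sequence is delayed by `i` steps. -/
theorem isAdicComplete_span_C_X (a : R) [IsAdicComplete (Ideal.span {a}) R] :
    IsAdicComplete (Ideal.span {C a, X}) (PowerSeries R) where
  haus' f hf := by
    ext1 i
    refine IsHausdorff.haus (I := Ideal.span {a}) inferInstance _ fun n => ?_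
    have h := hf (n + i)
    rw [SModEq.zero, smul_eq_mul, Ideal.mul_top] at h ⊢
    rw [Ideal.span_singleton_pow, Ideal.mem_span_singleton]
    have := (mem_span_C_X_pow_iff a _ f).1 h i
    rwa [Nat.add_sub_cancel] at this
  prec' f hf := by
    have hf' : ∀ {m n : ℕ}, m ≤ n → ∀ i, a ^ (m - i) ∣ coeff i (f m) - coeff i (f n) := by
      intro m n hmn i
      have h := hf hmn
      rw [SModEq.sub_mem, smul_eq_mul, Ideal.mul_top, mem_span_C_X_pow_iff] at h
      simpa using h i
    have hex : ∀ i, ∃ L : R, ∀ n, a ^ n ∣ coeff i (f (n + i)) - L := by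
      intro i
      obtain ⟨L, hL⟩ := IsPrecomplete.prec (I := Ideal.span {a}) inferInstance
        (f := fun n => coeff i (f (n + i))) (by
          intro m n hmn
          rw [SModEq.sub_mem, smul_eq_mul, Ideal.mul_top, Ideal.span_singleton_pow,
            Ideal.mem_span_singleton]
          simpa using hf' (Nat.add_le_add_right hmn i) i)
      refine ⟨L, fun n => ?_⟩
      have := hL n
      rwa [SModEq.sub_mem, smul_eq_mul, Ideal.mul_top, Ideal.span_singleton_pow,
        Ideal.mem_span_singleton] at this
    choose L hL using hex
    refine ⟨mk L, fun n => ?_⟩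
    rw [SModEq.sub_mem, smul_eq_mul, Ideal.mul_top, mem_span_C_X_pow_iff]
    intro i
    rw [map_sub, coeff_mk]
    -- For `i ≥ n` the criterion imposes no condition.
    rcases le_total i n with h | h
    · have := hL i (n - i)
      rwa [Nat.sub_add_cancel h] at this
    · rw [Nat.sub_eq_zero_of_le h, pow_zero]
      exact one_dvd _

end Completeness

/-! ### Evaluation of power series: existence and uniqueness -/

section Evaluation

variable {S : Type*} [CommRing S] (I : Ideal S) {a : S}

/-- `X^n` divides `P - Q`, and evaluation sends `X` into `I`. Modulo `I^n`, the value therefore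
depends only on the coefficients below `n`. -/
theorem eval_sub_mem_pow (ha : a ∈ I) {n : ℕ} {P Q : Polynomial S}
    (h : ∀ i < n, P.coeff i = Q.coeff i) : P.eval a - Q.eval a ∈ I ^ n := by
  obtain ⟨T, hT⟩ : (Polynomial.X : Polynomial S) ^ n ∣ P - Q := by
    rw [Polynomial.X_pow_dvd_iff]
    intro i hi
    rw [Polynomial.coeff_sub, h i hi, sub_self]
  rw [← Polynomial.eval_sub, hT, Polynomial.eval_mul, Polynomial.eval_pow, Polynomial.eval_X]
  exact Ideal.mul_mem_right _ _ (Ideal.pow_mem_pow ha n)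

/-- Evaluation of power series at `a ∈ I` modulo `I ^ n`. -/
noncomputable def evalModPow (ha : a ∈ I) (n : ℕ) : PowerSeries S →+* S ⧸ I ^ n where
  -- Any truncation order at least `n` gives the same class; order `n + 2` leaves `1` and `X`
  -- untouched for every `n`, including `0`.
  toFun f := Ideal.Quotient.mk (I ^ n) ((trunc (n + 2) f).eval a)
  map_zero' := by simp
  map_one' := by rw [trunc_one, Polynomial.eval_one, map_one]
  map_add' f g := by rw [map_add, Polynomial.eval_add, map_add]
  map_mul' f g := by
    rw [← map_mul, ← Polynomial.eval_mul, Ideal.Quotient.eq]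
    -- Truncation is not multiplicative, but the truncated product and the product of truncations
    -- agree below degree `n`.
    refine eval_sub_mem_pow I ha fun i hi => ?_
    rw [coeff_trunc, if_pos (by omega), coeff_mul, Polynomial.coeff_mul]
    refine Finset.sum_congr rfl fun x hx => ?_
    have hx' := Finset.HasAntidiagonal.mem_antidiagonal.1 hx
    rw [coeff_trunc, coeff_trunc, if_pos (by omega), if_pos (by omega)]

theorem evalModPow_apply (ha : a ∈ I) (n : ℕ) (f : PowerSeries S) :
    evalModPow I ha n f = Ideal.Quotient.mk (I ^ n) ((trunc (n + 2) f).eval a) := rfl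

/-- Over an adically complete ring, power series can be evaluated at the elements of the ideal. -/
theorem exists_ringHom_C_X [IsAdicComplete I S] (ha : a ∈ I) :
    ∃ ψ : PowerSeries S →+* S, (∀ c, ψ (C c) = c) ∧ ψ X = a := by
  let ψ := IsAdicComplete.liftRingHom I (evalModPow I ha) (by
    intro m n hmn
    ext f
    rw [RingHom.comp_apply, evalModPow_apply, evalModPow_apply]
    refine Ideal.Quotient.eq.2 ?_
    refine eval_sub_mem_pow I ha fun i hi => ?_
    rw [coeff_trunc, coeff_trunc, if_pos (by omega), if_pos (by omega)])
  have hψ : ∀ n f, Ideal.Quotient.mk (I ^ n) (ψ f)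
      = Ideal.Quotient.mk (I ^ n) ((trunc (n + 2) f).eval a) := fun n f =>
    IsAdicComplete.mk_liftRingHom I (evalModPow I ha) _ n f
  -- An element of a separated ring is known from its classes modulo all `I^n`; this computes `ψ` on
  -- constants and on `X`.
  have key : ∀ f b, (∀ n, (trunc (n + 2) f).eval a = b) → ψ f = b := by
    intro f b h
    refine sub_eq_zero.1 (IsHausdorff.haus (I := I) inferInstance _ fun n => ?_)
    rw [SModEq.zero, smul_eq_mul, Ideal.mul_top, ← Ideal.Quotient.eq, hψ, h]
  refine ⟨ψ, fun c => key _ _ fun n => ?_, key _ _ fun n => ?_⟩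
  · rw [trunc_C, Polynomial.eval_C]
  · rw [trunc_X, Polynomial.eval_X]

/-- Over a noetherian local ring, a homomorphism from power series that fixes the constants and maps
the variable to a non-unit is determined by the image of the variable. -/
theorem ringHom_ext_of_C_X [IsNoetherianRing S] [IsLocalRing S] {ψ ψ' : PowerSeries S →+* S}
    (hC : ∀ c, ψ (C c) = c) (hC' : ∀ c, ψ' (C c) = c) (hX : ψ X = ψ' X) (hu : ¬ IsUnit (ψ X)) :
    ψ = ψ' := by
  ext f
  -- By Krull's intersection theorem it suffices that the difference lie in every power of `(ψ X)`.
  -- The two maps agree on truncations, and both send the tail to a multiple of `(ψ X)^n`.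
  rw [← sub_eq_zero, ← Ideal.mem_bot,
    ← Ideal.iInf_pow_eq_bot_of_isLocalRing (Ideal.span {ψ X})
      (by rwa [Ne, Ideal.span_singleton_eq_top])]
  refine (Submodule.mem_iInf _).2 fun n => ?_
  obtain ⟨g, hg⟩ : (X : PowerSeries S) ^ n ∣ f - ∑ i ∈ Finset.range n, C (coeff i f) * X ^ i := by
    rw [X_pow_dvd_iff]
    intro m hm
    simp [coeff_C_mul, coeff_X_pow, hm]
  rw [eq_add_of_sub_eq hg, Ideal.span_singleton_pow, Ideal.mem_span_singleton]
  simp only [map_add, map_mul, map_sum, map_pow, hC, hC', ← hX, add_sub_add_right_eq_sub, ← mul_sub]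
  exact dvd_mul_right _ _

end Evaluation

end PowerSeries

namespace PadicLineIntegral

/-! ### Sections of `X` and units congruent to `1` -/

section SectionsOfX

variable {p : ℕ} [Fact p.Prime] {k : Type u} [Field k] [CharP k p] [PerfectRing k p]

theorem idealGamma_eq_span_C_X :
    idealGamma p k = Ideal.span {PowerSeries.C (p : O p k), PowerSeries.X} := by
  rw [idealGamma, map_natCast]

theorem isAdicComplete_idealGamma : IsAdicComplete (idealGamma p k) (GammaPlus p k) := by
  rw [idealGamma_eq_span_C_X]
  exact PowerSeries.isAdicComplete_span_C_X _

/-- `Γ₊` is local with maximal ideal `(p, u)`: a non-unit has a non-unit constant term, which is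
divisible by `p`. -/
theorem mem_idealGamma_of_not_isUnit {f : GammaPlus p k} (hf : ¬ IsUnit f) :
    f ∈ idealGamma p k := by
  rw [PowerSeries.isUnit_iff_constantCoeff] at hf
  have h1 : PowerSeries.constantCoeff f ∈ Ideal.span {(p : O p k)} := by
    rw [WittVector.mem_span_p_iff_coeff_zero_eq_zero]
    by_contra h
    exact hf (WittVector.isUnit_of_coeff_zero_ne_zero _ h)
  -- For the first power of the ideal, only the constant coefficient is constrained.
  have h2 := (PowerSeries.mem_span_C_X_pow_iff (p : O p k) 1 f).2 fun i => by
    cases i with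
    | zero => simpa [Ideal.mem_span_singleton] using h1
    | succ i => simp
  rwa [pow_one, ← idealGamma_eq_span_C_X] at h2

theorem Sections.map_X_mem (ψ : Sections p k) : ψ.ψ PowerSeries.X ∈ idealGamma p k :=
  mem_idealGamma_of_not_isUnit (not_isUnit_map_X ψ.ψ ψ.map_C)

theorem continuous_adicTopology {A B : Type*} [CommRing A] [CommRing B] {I : Ideal A} {J : Ideal B}
    (f : A →+* B) (h : I.map f ≤ J) : @Continuous _ _ I.adicTopology J.adicTopology f := by
  let : WithIdeal A := ⟨I⟩
  let : WithIdeal B := ⟨J⟩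
  exact (WithIdeal.uniformContinuous_of_map_le (f := f) h).continuous

/-- Completeness of `Γ₊` provides evaluation at `a`. It is continuous because the generators `p`,
`u`, `x` go to `p`, `u`, `a`, all in `(p, u)`. -/
theorem Sections.exists_map_X_eq {a : GammaPlus p k} (ha : a ∈ idealGamma p k) :
    ∃ ψ : Sections p k, ψ.ψ PowerSeries.X = a := by
  have := isAdicComplete_idealGamma (p := p) (k := k)
  obtain ⟨ψ, hC, hX⟩ := PowerSeries.exists_ringHom_C_X (idealGamma p k) ha
  refine ⟨⟨ψ, hC, continuous_adicTopology ψ ?_⟩, hX⟩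
  rw [idealOX, Ideal.map_span, Ideal.span_le]
  rintro _ ⟨x, rfl | rfl | rfl, rfl⟩
  · rw [map_natCast]
    exact Ideal.subset_span (by simp)
  · rw [hC]
    exact Ideal.subset_span (by simp)
  · rwa [hX]

theorem Sections.bijOn_map_one_add_X (p : ℕ) [Fact p.Prime] (k : Type u) [Field k] [CharP k p]
    [PerfectRing k p] :
    Set.BijOn (fun ψ : Sections p k => ψ.ψ (1 + PowerSeries.X)) Set.univ
      {v : GammaPlus p k | IsUnit v ∧ v - 1 ∈ idealGamma p k} := by
  refine ⟨fun ψ _ => ⟨?_, ?_⟩, fun ψ _ ψ' _ h => ?_, fun v hv => ?_⟩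
  · refine IsUnit.map ψ.ψ ?_
    rw [PowerSeries.isUnit_iff_constantCoeff]
    simp
  · simpa using ψ.map_X_mem
  · have hX : ψ.ψ PowerSeries.X = ψ'.ψ PowerSeries.X := by simpa using h
    have h1 : ψ.ψ = ψ'.ψ := PowerSeries.ringHom_ext_of_C_X ψ.map_C ψ'.map_C hX
      (not_isUnit_map_X ψ.ψ ψ.map_C)
    cases ψ
    cases ψ'
    simpa using h1
  · obtain ⟨ψ, hψ⟩ := Sections.exists_map_X_eq hv.2
    exact ⟨ψ, Set.mem_univ _, by simp [hψ]⟩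

end SectionsOfX

end PadicLineIntegral

theorem mainTheorem4 (p : ℕ) [Fact p.Prime] (k : Type u) [Field k] [CharP k p] [PerfectRing k p] :
    -- `ψ ↦ ψ(1 + x)` identifies the sections with the units congruent to `1` modulo `(p, u)`
    Set.BijOn (fun ψ : Sections p k => ψ.ψ (1 + PowerSeries.X)) Set.univ
      {v : GammaPlus p k | IsUnit v ∧ v - 1 ∈ idealGamma p k} ∧
    -- the identification of the double cosets with `𝓔₊ \ 𝓡₊` by the upper right entry
    ∃ β : Cosets p k ≃ RModE p k,
      (∀ V : U (RPlus p k), β (DoubleCoset.mk (UE p k) (UK p k) V)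
        = Submodule.Quotient.mk ((V : GL (Fin 2) (RPlus p k)) 0 1)) ∧
      -- the line integral of the module on `X` is well defined and equals the logarithm
      (∀ (ψ : Sections p k) (v : (GammaPlus p k)ˣ),
        ψ.ψ (1 + PowerSeries.X) = (v : GammaPlus p k) →
          ((logModule p k).pullbackSection ψ).Iso (dlogModule (dGamma p k) (dlog v)) ∧
          (∃! c, ((logModule p k).pullbackSection ψ).toE.HasInvariant c) ∧
          β (lineIntegral (logModule p k) ψ) = logDagger (reduction v)) ∧
      -- for every unit `v`, the invariant of the module with `∇ e₂ = e₁ ⊗ dv / v` is `log† v`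
      (∀ v : (GammaPlus p k)ˣ,
        (∃! c, (dlogModule (dGamma p k) (dlog v)).toE.HasInvariant c) ∧
        β (dlogModule (dGamma p k) (dlog v)).toE.invariant = logDagger (reduction v)) := by
  refine ⟨Sections.bijOn_map_one_add_X p k, cosetsEquiv p k, cosetsEquiv_mk, fun ψ v hv => ?_,
    fun v => ?_⟩
  · have h := logModule_pullbackSection_nabla_e_one ψ v hv
    exact ⟨FramedModule.iso_of_nabla_eq _ _ h (dlogModule_nabla_e_one _),
      FramedModule.existsUnique_hasInvariant _, FramedModule.cosetsEquiv_invariant_toE _ v h⟩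
  · exact ⟨FramedModule.existsUnique_hasInvariant _,
      FramedModule.cosetsEquiv_invariant_toE _ v (dlogModule_nabla_e_one _)⟩
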